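/- Let $n\ge 2$, let $C_n^*=\{w\in\mathbb C^{n+1}\setminus\{0\}: w_0^2+\dots+w_n^2=0\}$ be the punctured conifold, write $w=u+iv$ with $u,v\in\mathbb R^{n+1}$, and put $t=|w|^2$. For $C>0$ let $g_K$ be the metric on $C_n^*$ with Kähler form $\omega_K=i\partial\bar\partial K$, $K=C\,t^{(n-1)/n}$ (so $g_K(X,Y)=\omega_K(X,iY)$). Let $$S=\Big\{(\hat u,\hat v)\in\mathbb R^{n+1}\times\mathbb R^{n+1}: |\hat u|=|\hat v|=1,\ \hat u\cdot\hat v=0\Big\}$$ be the unit conormal (cotangent) bundle of the round sphere $S^n$, and let $$h'=\sum_{j=0}^n\big(d\hat u_j^2+d\hat v_j^2\big)-\frac2n\Big(\sum_{j=0}^n\hat u_j\,d\hat v_j\Big)^2 .$$ Then: 1. $g_K$ is a Ricci-flat Kähler metric on $C_n^*$. 2. With $\hat u=u/|u|$, $\hat v=v/|u|$ and $r=\sqrt{2C}\;t^{(n-1)/(2n)}$, the map $w\mapsto(r,(\hat u,\hat v))$ is a diffeomorphism of $C_n^*$ onto $\mathbb R_{>0}\times S$, and under it $$g_K=dr^2+r^2h,\qquad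 h=\frac{n-1}{2n}\,h'.$$ 3. $h=\frac{n-1}{2n}h'$ is a Sasaki–Einstein metric on $S$: it is Einstein, and its metric cone $(\mathbb R_{>0}\times S,\ dr^2+r^2h)$ is Kähler. Thus $h'$ is, up to this constant factor, a Sasaki–Einstein metric on the unit conormal bundle of the round $S^n$. -/

import Mathlib

open scoped ContDiff Topology ComplexConjugate

noncomputable section

namespace ConifoldCone

/-! ### Embedded submanifolds and Riemannian geometry in local parametrizations

A submanifold is a subset `M` of a real normed space `E`, a Riemannian metric on it is the
restriction to the tangent spaces of a field of bilinear forms `g : E → BilinForm ℝ E`. -/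

section General

variable {E E' F : Type*} [NormedAddCommGroup E] [NormedSpace ℝ E]
  [NormedAddCommGroup E'] [NormedSpace ℝ E'] [NormedAddCommGroup F] [NormedSpace ℝ F]

/-- `φ : U → M` is a smooth local parametrization of `M ⊆ E`: a smooth immersion of the open set
`U ⊆ F` which is a homeomorphism onto a relatively open subset of `M`. -/
structure IsParam (M : Set E) (U : Set F) (φ : F → E) : Prop where
  isOpen : IsOpen U
  smooth : ContDiffOn ℝ ∞ φ U
  immersion : ∀ x ∈ U, Function.Injective (fderiv ℝ φ x)
  homeo : ∃ (W : Set E) (ψ : E → F), IsOpen W ∧ φ '' U = M ∩ W ∧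
    Set.LeftInvOn ψ φ U ∧ ContinuousOn ψ (M ∩ W)

/-- The vectors tangent to `M` at `p`: velocities at `p` of curves in `M`. -/
def tangentVectors (M : Set E) (p : E) : Set E :=
  {v | ∃ γ : ℝ → E, γ 0 = p ∧ (∀ᶠ s in 𝓝 (0 : ℝ), γ s ∈ M) ∧ HasDerivAt γ v 0}

/-- The pulled back metric `φ^* g` in a local parametrization `φ`. -/
def pullback (g : E → LinearMap.BilinForm ℝ E) (φ : F → E) (x a b : F) : ℝ :=
  g (φ x) (fderiv ℝ φ x a) (fderiv ℝ φ x b)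

variable (F) in
/-- `M` is a smooth embedded submanifold modelled on `F`, and `g` restricts to a smooth Riemannian
metric on it. -/
def IsRiemannianMetric (M : Set E) (g : E → LinearMap.BilinForm ℝ E) : Prop :=
  ∀ p ∈ M, ∃ (U : Set F) (φ : F → E), IsParam M U φ ∧ p ∈ φ '' U ∧
    (∀ a b, ContDiffOn ℝ ∞ (fun x => pullback g φ x a b) U) ∧
    (∀ x ∈ U, ∀ a b, pullback g φ x a b = pullback g φ x b a) ∧
    (∀ x ∈ U, ∀ a, a ≠ 0 → 0 < pullback g φ x a a)

/-- `Γ` is the Christoffel map on `U` of the metric `G` (so that the Levi-Civita connection is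
`∇_a Y = D_a Y + Γ(a, Y)`): Koszul's formula for constant vector fields. For a Riemannian metric `G`
it determines `Γ` on `U`. -/
def IsChristoffel (U : Set F) (G : F → F → F → ℝ) (Γ : F → F →L[ℝ] F →L[ℝ] F) : Prop :=
  ∀ x ∈ U, ∀ a b c, 2 * G x (Γ x a b) c =
    fderiv ℝ (fun y => G y b c) x a + fderiv ℝ (fun y => G y a c) x b
      - fderiv ℝ (fun y => G y a b) x c

/-- The linear map `a ↦ R(a, b) c` at `x`, where
`R(a, b) c = (D_a Γ)(b, c) - (D_b Γ)(a, c) + Γ(a, Γ(b, c)) - Γ(b, Γ(a, c))`. -/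
def curvature (Γ : F → F →L[ℝ] F →L[ℝ] F) (x b c : F) : F →ₗ[ℝ] F where
  toFun a := fderiv ℝ Γ x a b c - fderiv ℝ Γ x b a c + Γ x a (Γ x b c) - Γ x b (Γ x a c)
  map_add' a a' := by simp; abel
  map_smul' s a := by simp [smul_sub, smul_add]

/-- The Ricci tensor `Ric(b, c) = tr (a ↦ R(a, b) c)`. -/
def ricci (Γ : F → F →L[ℝ] F →L[ℝ] F) (x b c : F) : ℝ :=
  LinearMap.trace ℝ F (curvature Γ x b c)

variable (F) in
/-- `Ric(g) = lam • g` on `M`. The Ricci tensor at `p` is computed in a local parametrization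
around `p`; being a tensor, it does not depend on the parametrization. -/
def IsEinstein (M : Set E) (g : E → LinearMap.BilinForm ℝ E) (lam : ℝ) : Prop :=
  ∀ p ∈ M, ∃ (U : Set F) (φ : F → E) (x : F) (Γ : F → F →L[ℝ] F →L[ℝ] F),
    IsParam M U φ ∧ x ∈ U ∧ φ x = p ∧ IsChristoffel U (pullback g φ) Γ ∧
    ∀ b c, ricci Γ x b c = lam * pullback g φ x b c

/-- `Ψ` restricts to a diffeomorphism from `M` onto `N` (a map on a submanifold is smooth if it
extends smoothly to a neighbourhood). -/
def IsDiffeo (M : Set E) (N : Set E') (Ψ : E → E') : Prop :=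
  Set.BijOn Ψ M N ∧ (∃ V, IsOpen V ∧ M ⊆ V ∧ ContDiffOn ℝ ∞ Ψ V) ∧
    ∃ Ξ : E' → E, Set.LeftInvOn Ξ Ψ M ∧ ∃ V, IsOpen V ∧ N ⊆ V ∧ ContDiffOn ℝ ∞ Ξ V

/-- `Ψ` maps `(M, g)` isometrically to `(N, k)`, i.e. `Ψ^* k = g` on the tangent spaces of `M`. -/
def PullsBackTo (M : Set E) (g : E → LinearMap.BilinForm ℝ E)
    (k : E' → LinearMap.BilinForm ℝ E') (Ψ : E → E') : Prop :=
  ∀ p ∈ M, ∀ a ∈ tangentVectors M p, ∀ b ∈ tangentVectors M p,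
    k (Ψ p) (fderiv ℝ Ψ p a) (fderiv ℝ Ψ p b) = g p a b

/-- `(M, J, g)` is a Kähler manifold of complex dimension `n`: `g` is a Riemannian metric, and `M` is
covered by parametrizations by open subsets of `ℂⁿ` in which `J` is multiplication by `i` (so that
`J` is the complex structure of a complex manifold), `g` is Hermitian, and the fundamental form
`ω(a, b) = g(J a, b)` is closed. -/
def IsKahler (n : ℕ) (M : Set E) (J : E → E →ₗ[ℝ] E) (g : E → LinearMap.BilinForm ℝ E) : Prop :=
  IsRiemannianMetric (Fin n → ℂ) M g ∧
  ∀ p ∈ M, ∃ (U : Set (Fin n → ℂ)) (φ : (Fin n → ℂ) → E), IsParam M U φ ∧ p ∈ φ '' U ∧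
    (∀ x ∈ U, ∀ a, fderiv ℝ φ x (Complex.I • a) = J (φ x) (fderiv ℝ φ x a)) ∧
    (∀ x ∈ U, ∀ a b, pullback g φ x (Complex.I • a) (Complex.I • b) = pullback g φ x a b) ∧
    (∀ x ∈ U, ∀ a b c,
      fderiv ℝ (fun y => pullback g φ y (Complex.I • b) c) x a
        + fderiv ℝ (fun y => pullback g φ y (Complex.I • c) a) x b
        + fderiv ℝ (fun y => pullback g φ y (Complex.I • a) b) x c = 0)

/-- The cone `ℝ_{>0} × S`. -/
def cone (S : Set E) : Set (ℝ × E) := {q | 0 < q.1 ∧ q.2 ∈ S}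

/-- The cone metric `dr² + r² h`. -/
def coneMetric (h : E → LinearMap.BilinForm ℝ E) (q : ℝ × E) : LinearMap.BilinForm ℝ (ℝ × E) :=
  LinearMap.mk₂ ℝ (fun a b => a.1 * b.1 + q.1 ^ 2 * h q.2 a.2 b.2)
    (by intros; simp; ring) (by intros; simp; ring) (by intros; simp; ring) (by intros; simp; ring)

/-- `h` is a Sasakian metric on the `(2n-1)`-dimensional manifold `S`: its metric cone is
Kähler for some complex structure. -/
def IsSasakian (n : ℕ) (S : Set E) (h : E → LinearMap.BilinForm ℝ E) : Prop :=
  IsRiemannianMetric (Fin (2 * n - 1) → ℝ) S h ∧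
    ∃ J : (ℝ × E) → (ℝ × E) →ₗ[ℝ] (ℝ × E), IsKahler n (cone S) J (coneMetric h)

/-- A Sasaki-Einstein metric is one that is both Sasakian and Einstein. -/
def IsSasakiEinstein (n : ℕ) (S : Set E) (h : E → LinearMap.BilinForm ℝ E) : Prop :=
  IsSasakian n S h ∧ ∃ lam : ℝ, IsEinstein (Fin (2 * n - 1) → ℝ) S h lam

end General

/-! ### Kähler potentials on `ℂᵐ` -/

/-- `∂F/∂w_j = (∂F/∂u_j - i ∂F/∂v_j) / 2`. -/
def dw {m : ℕ} (j : Fin m) (F : (Fin m → ℂ) → ℂ) (w : Fin m → ℂ) : ℂ :=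
  (fderiv ℝ F w (Pi.single j 1) - Complex.I * fderiv ℝ F w (Pi.single j Complex.I)) / 2

/-- `∂F/∂w̄_j = (∂F/∂u_j + i ∂F/∂v_j) / 2`. -/
def dwbar {m : ℕ} (j : Fin m) (F : (Fin m → ℂ) → ℂ) (w : Fin m → ℂ) : ℂ :=
  (fderiv ℝ F w (Pi.single j 1) + Complex.I * fderiv ℝ F w (Pi.single j Complex.I)) / 2

/-- The symmetric form `g(a, b) = ω(a, i b)` of
`ω = i ∂∂̄K = i ∑ K_{j k̄} dw_j ∧ dw̄_k`, that is `g(a, b) = 2 Re ∑ K_{j k̄} a_j b̄_k`. -/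
def potentialMetric {m : ℕ} (K : (Fin m → ℂ) → ℝ) (w : Fin m → ℂ) :
    LinearMap.BilinForm ℝ (Fin m → ℂ) :=
  LinearMap.mk₂ ℝ
    (fun a b => 2 * (∑ j, ∑ k, dw j (dwbar k (fun z => (K z : ℂ))) w * a j * conj (b k)).re)
    (by intros; simp only [Pi.add_apply, mul_add, add_mul, Finset.sum_add_distrib, Complex.add_re])
    (by
      intro c a b
      have : ∀ z : ℂ, c • (2 * z.re) = 2 * ((c : ℂ) * z).re := by intro z; simp; ring
      rw [this]
      simp only [Finset.mul_sum, Pi.smul_apply, Complex.real_smul]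
      congr 2
      refine Finset.sum_congr rfl fun j _ => Finset.sum_congr rfl fun k _ => ?_
      ring)
    (by intros; simp only [Pi.add_apply, map_add, mul_add, Finset.sum_add_distrib, Complex.add_re])
    (by
      intro c a b
      have : ∀ z : ℂ, c • (2 * z.re) = 2 * ((c : ℂ) * z).re := by intro z; simp; ring
      rw [this]
      simp only [Finset.mul_sum, Pi.smul_apply, Complex.real_smul, map_mul, Complex.conj_ofReal]
      congr 2
      refine Finset.sum_congr rfl fun j _ => Finset.sum_congr rfl fun k _ => ?_
      ring)

/-- Multiplication by `i` on `ℂᵐ`. -/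
def mulI (m : ℕ) : (Fin m → ℂ) →ₗ[ℝ] (Fin m → ℂ) where
  toFun a := Complex.I • a
  map_add' a b := smul_add _ a b
  map_smul' c a := smul_comm _ c a

/-! ### The conifold and the unit conormal bundle of the sphere -/

/-- `C_n^*`: the nonzero `w ∈ ℂ^{n+1}` with `w_0² + ⋯ + w_n² = 0`. -/
def conifold (n : ℕ) : Set (Fin (n + 1) → ℂ) := {w | w ≠ 0 ∧ ∑ j, w j ^ 2 = 0}

/-- `t = |w|²`. -/
def normSq {n : ℕ} (w : Fin (n + 1) → ℂ) : ℝ := ∑ j, Complex.normSq (w j)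

/-- The metric `g_K` on the conifold with Kähler potential `K = C t^{(n-1)/n}`. -/
def conifoldMetric (n : ℕ) (C : ℝ) : (Fin (n + 1) → ℂ) → LinearMap.BilinForm ℝ (Fin (n + 1) → ℂ) :=
  potentialMetric fun w => C * normSq w ^ (((n : ℝ) - 1) / n)

/-- The unit conormal bundle of the round sphere `S^n ⊆ ℝ^{n+1}`: the pairs `(û, v̂)` with
`|û| = |v̂| = 1` and `û · v̂ = 0`. -/
def unitConormal (n : ℕ) : Set ((Fin (n + 1) → ℝ) × (Fin (n + 1) → ℝ)) :=
  {p | ∑ j, p.1 j ^ 2 = 1 ∧ ∑ j, p.2 j ^ 2 = 1 ∧ ∑ j, p.1 j * p.2 j = 0}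

/-- `h' = ∑ (dû_j² + dv̂_j²) - (2/n) (∑ û_j dv̂_j)²`. -/
def hPrime (n : ℕ) (p : (Fin (n + 1) → ℝ) × (Fin (n + 1) → ℝ)) :
    LinearMap.BilinForm ℝ ((Fin (n + 1) → ℝ) × (Fin (n + 1) → ℝ)) :=
  LinearMap.mk₂ ℝ
    (fun a b => ∑ j, (a.1 j * b.1 j + a.2 j * b.2 j)
      - 2 / (n : ℝ) * ((∑ j, p.1 j * a.2 j) * (∑ j, p.1 j * b.2 j)))
    (by
      intros
      simp only [Prod.fst_add, Prod.snd_add, Pi.add_apply, mul_add, add_mul,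
        Finset.sum_add_distrib]
      ring)
    (by
      intros
      simp only [Prod.smul_fst, Prod.smul_snd, Pi.smul_apply, smul_eq_mul, mul_sub, mul_add,
        Finset.mul_sum, Finset.sum_mul, mul_assoc, mul_left_comm])
    (by
      intros
      simp only [Prod.fst_add, Prod.snd_add, Pi.add_apply, mul_add,
        Finset.sum_add_distrib]
      ring)
    (by
      intros
      simp only [Prod.smul_fst, Prod.smul_snd, Pi.smul_apply, smul_eq_mul, mul_sub, mul_add,
        Finset.mul_sum, Finset.sum_mul, mul_assoc, mul_left_comm])

/-- The metric `((n-1)/(2n)) h'`. -/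
def linkMetric (n : ℕ) (p : (Fin (n + 1) → ℝ) × (Fin (n + 1) → ℝ)) :
    LinearMap.BilinForm ℝ ((Fin (n + 1) → ℝ) × (Fin (n + 1) → ℝ)) :=
  (((n : ℝ) - 1) / (2 * n)) • hPrime n p

/-- The polar coordinates `w = u + i v ↦ (r, (û, v̂))` with `û = u / |u|`, `v̂ = v / |u|` and
`r = √(2C) t^{(n-1)/(2n)}`. -/
def polar (n : ℕ) (C : ℝ) (w : Fin (n + 1) → ℂ) :
    ℝ × ((Fin (n + 1) → ℝ) × (Fin (n + 1) → ℝ)) :=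
  (√(2 * C) * normSq w ^ (((n : ℝ) - 1) / (2 * n)),
    (fun j => (w j).re / √(∑ k, (w k).re ^ 2), fun j => (w j).im / √(∑ k, (w k).re ^ 2)))

end ConifoldCone

end

/-! All the geometry is done extrinsically. The conifold and the unit conormal bundle are both
pieces of quadrics β(q, q) = k in a vector space E, with tangent space β(p, X) = 0. A connection is
written ∇ = D + Q, where D is the flat derivative of E and Q is an explicit field of symmetric
bilinear maps E × E → E. If the normal part of Q is the second fundamental form, ∇ preserves
tangency (`tangential_of_quadric`). If ∇ also preserves the metric, it induces the Levi-Civita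
connection (`IsLinearParam.isChristoffel`), and the Ricci tensor is the trace over E of the
curvature expression of Q composed with a projection onto the tangent space
(`IsLinearParam.ricci_eq`). The charts come from the inverse function theorem with a linear left
inverse, and they drop out of every curvature computation.

Conifold. Put κ = (n-1)/n - 1 = -1/n. Then g_K is a constant times t^κ Re H, with H(a, b) = ⟨a, b⟩ +
κ⟨a, w⟩⟨w, b⟩/t. The vector w̄ is H-normal to the conifold, so Q is the Christoffel tensor of the
ambient Hermitian metric plus (A · B) w̄/t. It is complex linear, hence ∇J = 0 and the fundamental
form is closed (`isKahler_of_isLinearParam`). On tangent vectors the curvature collapses to ∂̄_A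
Q(B, C) - ∂̄_B Q(A, C) (`curvature_conifoldConnection`). As a function of A the first term is
antilinear and has real trace zero. The second is complex linear, and its complex trace over the
tangent space is (nκ + 1) ∂∂̄ log t evaluated at (C, B̄), which vanishes for the chosen exponent
(`trace_dbarLinear`).

Polar coordinates. On the conifold |u|² = |v|² = t/2 and u · v = 0, so the inverse map is explicit.
On tangent vectors, comparing the two metrics becomes a rational identity (`pullsBackTo_polar`).

Link. The cone over S is Kähler because it is isometric to the conifold (`IsKahler.of_diffeo`). The
Einstein equation for h is verified directly: Q is the Euclidean second fundamental form of S plus a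
correction from the contact form η = û · dv̂, and the Ricci trace is a sum of traces of rank one and
block maps (`trace_curvature_linkConnection`). -/

noncomputable section

namespace ConifoldCone

/-! ### Charts of regular level sets with a linear left inverse -/

section LevelSet

variable {𝕜 E F G : Type*} [RCLike 𝕜] [NormedAddCommGroup E] [NormedSpace 𝕜 E]
  [FiniteDimensional 𝕜 E] [NormedAddCommGroup F] [NormedSpace 𝕜 F] [FiniteDimensional 𝕜 F]
  [NormedAddCommGroup G] [NormedSpace 𝕜 G] [FiniteDimensional 𝕜 G]

/-- A surjective linear map `D : E → G` is completed by a linear map `L : E → F` to an isomorphism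
of `E` with `G × F`, if the dimensions add up. -/
theorem exists_prod_equiv (D : E →L[𝕜] G) (hD : Function.Surjective D)
    (hdim : Module.finrank 𝕜 F + Module.finrank 𝕜 G = Module.finrank 𝕜 E) :
    ∃ (L : E →L[𝕜] F) (e : E ≃L[𝕜] G × F), (e : E →L[𝕜] G × F) = D.prod L := by
  have hker : Module.finrank 𝕜 (LinearMap.ker (D : E →ₗ[𝕜] G)) = Module.finrank 𝕜 F := by
    have h1 := LinearMap.finrank_range_add_finrank_ker (D : E →ₗ[𝕜] G)
    have h2 : LinearMap.range (D : E →ₗ[𝕜] G) = ⊤ := LinearMap.range_eq_top.2 hD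
    rw [h2, finrank_top] at h1
    omega
  let e₀ := LinearEquiv.ofFinrankEq _ _ hker
  obtain ⟨π, hπ⟩ := (LinearMap.ker (D : E →ₗ[𝕜] G)).subtype.exists_leftInverse_of_injective
    (LinearMap.ker_eq_bot.2 Subtype.val_injective)
  let L : E →ₗ[𝕜] F := e₀.toLinearMap ∘ₗ π
  have hinj : Function.Injective ((D : E →ₗ[𝕜] G).prod L) := by
    rw [← LinearMap.ker_eq_bot, LinearMap.ker_eq_bot']
    intro x hx
    have h1 : D x = 0 := congrArg Prod.fst hx
    have h2 : e₀ (π x) = 0 := congrArg Prod.snd hx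
    have h3 := LinearMap.congr_fun hπ ⟨x, h1⟩
    have h4 : π x = 0 := by simpa using h2
    have h5 : π x = ⟨x, h1⟩ := h3
    exact congrArg Subtype.val (h5.symm.trans h4)
  have hfr : Module.finrank 𝕜 E = Module.finrank 𝕜 (G × F) := by
    rw [Module.finrank_prod, ← hdim, add_comm]
  refine ⟨LinearMap.toContinuousLinearMap L,
    (LinearEquiv.ofInjectiveOfFinrankEq _ hinj hfr).toContinuousLinearEquiv, ?_⟩
  ext x <;> rfl

/-- A level set of `c` near a regular point `p` is parametrized by a smooth map which has a linear
left inverse `L`. -/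
theorem exists_param_levelSet (c : E → G) (hc : ContDiff 𝕜 ∞ c) (p : E)
    (hD : Function.Surjective (fderiv 𝕜 c p))
    (hdim : Module.finrank 𝕜 F + Module.finrank 𝕜 G = Module.finrank 𝕜 E)
    {O : Set E} (hO : IsOpen O) (hp : p ∈ O) :
    ∃ (U : Set F) (φ : F → E) (L : E →L[𝕜] F) (W : Set E), IsOpen U ∧ IsOpen W ∧ W ⊆ O ∧
      p ∈ φ '' U ∧ ContDiffOn 𝕜 ∞ φ U ∧ φ '' U = {q | c q = c p} ∩ W ∧
      (∀ x ∈ U, L (φ x) = x) ∧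
      ∀ x ∈ U, ∀ X, fderiv 𝕜 c (φ x) X = 0 → fderiv 𝕜 φ x (L X) = X := by
  have : CompleteSpace E := FiniteDimensional.complete 𝕜 E
  obtain ⟨L, e, he⟩ := exists_prod_equiv (F := F) (fderiv 𝕜 c p) hD hdim
  let Φ : E → G × F := fun q => (c q, L q)
  have hΦ : ContDiff 𝕜 ∞ Φ := hc.prodMk L.contDiff
  have hΦd : ∀ q, HasFDerivAt Φ ((fderiv 𝕜 c q).prod L) q := fun q =>
    ((hc.differentiable (by simp)) q).hasFDerivAt.prodMk L.hasFDerivAt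
  have hΦp : HasFDerivAt Φ (e : E →L[𝕜] G × F) p := by rw [he]; exact hΦd p
  -- The inverse function theorem gives smoothness of the inverse only at the image of `p`.
  -- Shrinking to the open set where the derivative of `Φ = (c, L)` is invertible gives it on the
  -- whole target.
  let R : Set E := fderiv 𝕜 Φ ⁻¹' Set.range ((↑) : (E ≃L[𝕜] G × F) → E →L[𝕜] G × F)
  have hR : IsOpen R := ContinuousLinearEquiv.isOpen.preimage (hΦ.continuous_fderiv (by simp))
  let h₀ := hΦ.contDiffAt.toOpenPartialHomeomorph Φ hΦp (by simp)
  let h := h₀.restrOpen (O ∩ R) (hO.inter hR)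
  have hcoe : (h : E → G × F) = Φ := rfl
  have hsrc : h.source = h₀.source ∩ (O ∩ R) := h₀.restrOpen_source _ _
  have hps : p ∈ h.source := by
    rw [hsrc]
    exact ⟨hΦ.contDiffAt.mem_toOpenPartialHomeomorph_source hΦp (by simp), hp, e, hΦp.fderiv.symm⟩
  have hsm : ∀ y ∈ h.target, ContDiffAt 𝕜 ∞ h.symm y := by
    intro y hy
    have hs := h.map_target hy
    rw [hsrc] at hs
    obtain ⟨e', he'⟩ := hs.2.2
    refine h.contDiffAt_symm hy (f₀' := e') ?_ hΦ.contDiffAt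
    rw [he']
    exact (hΦ.differentiable (by simp) _).hasFDerivAt
  -- The chart is the slice of the inverse of `Φ` at the fixed value `c p`. Since `L` is the second
  -- component of `Φ`, it is a left inverse of this chart.
  let ι : F → G × F := fun y => (c p, y)
  have hι : ContDiff 𝕜 ∞ ι := contDiff_const.prodMk contDiff_id
  have hιd : ∀ y, HasFDerivAt ι (ContinuousLinearMap.inr 𝕜 G F) y := fun y =>
    hasFDerivAt_prodMk_right (c p) y
  have hright : ∀ y ∈ ι ⁻¹' h.target, Φ (h.symm (ι y)) = ι y := fun y hy => h.right_inv hy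
  refine ⟨ι ⁻¹' h.target, fun y => h.symm (ι y), L, h.source, h.open_target.preimage hι.continuous,
    h.open_source, ?_, ?_, ?_, ?_, ?_, ?_⟩
  · rw [hsrc]; exact fun q hq => hq.2.1
  · exact ⟨L p, h.map_source hps, h.left_inv hps⟩
  · intro y hy
    exact ((hsm _ hy).comp y hι.contDiffAt).contDiffWithinAt
  · ext q
    constructor
    · rintro ⟨y, hy, rfl⟩
      exact ⟨congrArg Prod.fst (hright y hy), h.map_target hy⟩
    · rintro ⟨hq, hqs⟩
      have hιq : ι (L q) = h q := Prod.ext (Eq.symm hq) rfl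
      exact ⟨L q, by simpa only [Set.mem_preimage, hιq] using h.map_source hqs,
        by simp only [hιq]; exact h.left_inv hqs⟩
  · intro y hy
    exact congrArg Prod.snd (hright y hy)
  · intro y hy X hX
    have hs := h.map_target hy
    have h1 : HasFDerivAt h.symm (fderiv 𝕜 h.symm (ι y)) (Φ (h.symm (ι y))) := by
      rw [hright y hy]
      exact ((hsm _ hy).differentiableAt (by simp)).hasFDerivAt
    have h2 := h1.comp _ (hΦd (h.symm (ι y)))
    have h3 : HasFDerivAt (h.symm ∘ Φ) (ContinuousLinearMap.id 𝕜 E) (h.symm (ι y)) :=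
      (hasFDerivAt_id _).congr_of_eventuallyEq
        (Filter.eventuallyEq_of_mem (h.open_source.mem_nhds hs) fun q hq => h.left_inv hq)
    have h4 := DFunLike.congr_fun (h2.unique h3) X
    have h5 := (((hsm _ hy).differentiableAt (by simp)).hasFDerivAt.comp y (hιd y)).fderiv
    have h6 : fderiv 𝕜 (fun y => h.symm (ι y)) y (L X) = fderiv 𝕜 h.symm (ι y) (0, L X) := by
      rw [show (fun y => h.symm (ι y)) = h.symm ∘ ι from rfl, h5]; rfl
    rw [h6]
    simpa [hX] using h4

end LevelSet

/-! ### Differentiation of fields of bilinear forms -/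

section Bilinear

variable {E F : Type*} [NormedAddCommGroup E] [NormedSpace ℝ E] [FiniteDimensional ℝ E]
  [NormedAddCommGroup F] [NormedSpace ℝ F]

theorem contDiffOn_toContinuousBilinearMap {s : Set E} {g : E → LinearMap.BilinForm ℝ E}
    (hg : ∀ B C, ContDiffOn ℝ ∞ (fun q => g q B C) s) :
    ContDiffOn ℝ ∞ (fun q => LinearMap.toContinuousBilinearMap (g q)) s :=
  contDiffOn_clm_apply.2 fun B => contDiffOn_clm_apply.2 fun C => hg B C

theorem contDiffOn_bilinForm {s : Set E} {g : E → LinearMap.BilinForm ℝ E}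
    (hg : ∀ B C, ContDiffOn ℝ ∞ (fun q => g q B C) s) {U : Set F} {φ β γ : F → E}
    (hφ : ContDiffOn ℝ ∞ φ U) (hm : Set.MapsTo φ U s) (hβ : ContDiffOn ℝ ∞ β U)
    (hγ : ContDiffOn ℝ ∞ γ U) : ContDiffOn ℝ ∞ (fun y => g (φ y) (β y) (γ y)) U :=
  (((contDiffOn_toContinuousBilinearMap hg).comp hφ hm).clm_apply hβ).clm_apply hγ

theorem fderiv_bilinForm {s : Set E} (hs : IsOpen s) {g : E → LinearMap.BilinForm ℝ E}
    (hg : ∀ B C, ContDiffOn ℝ ∞ (fun q => g q B C) s) {x : F} {φ β γ : F → E}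
    (hφ : DifferentiableAt ℝ φ x) (hm : φ x ∈ s) (hβ : DifferentiableAt ℝ β x)
    (hγ : DifferentiableAt ℝ γ x) (a : F) :
    fderiv ℝ (fun y => g (φ y) (β y) (γ y)) x a =
      fderiv ℝ (fun q => g q (β x) (γ x)) (φ x) (fderiv ℝ φ x a)
        + g (φ x) (fderiv ℝ β x a) (γ x) + g (φ x) (β x) (fderiv ℝ γ x a) := by
  let G : E → E →L[ℝ] E →L[ℝ] ℝ := fun q => LinearMap.toContinuousBilinearMap (g q)
  have hG : HasFDerivAt G (fderiv ℝ G (φ x)) (φ x) :=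
    (((contDiffOn_toContinuousBilinearMap hg).contDiffAt (hs.mem_nhds hm)).differentiableAt
      (by simp)).hasFDerivAt
  have h0 : HasFDerivAt (fun y => G (φ y)) ((fderiv ℝ G (φ x)).comp (fderiv ℝ φ x)) x :=
    HasFDerivAt.comp (g := G) (G := E →L[ℝ] E →L[ℝ] ℝ) x hG hφ.hasFDerivAt
  have h1 := (h0.clm_apply hβ.hasFDerivAt).clm_apply hγ.hasFDerivAt
  have h2 := (hG.clm_apply (hasFDerivAt_const (β x) (φ x))).clm_apply
    (hasFDerivAt_const (γ x) (φ x))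
  have e1 : fderiv ℝ (fun y => g (φ y) (β y) (γ y)) x = _ := h1.fderiv
  have e2 : fderiv ℝ (fun q => g q (β x) (γ x)) (φ x) = _ := h2.fderiv
  have hGa : ∀ q B C, G q B C = g q B C := fun _ _ _ => rfl
  rw [e1, e2]
  simp [hGa]
  ring

end Bilinear

/-! ### Connections D + Q on submanifolds and their Ricci tensor -/

section Connection

variable {E F : Type*} [NormedAddCommGroup E] [NormedSpace ℝ E]
  [NormedAddCommGroup F] [NormedSpace ℝ F]

/-- A local parametrization `φ` of `M` with a linear left inverse `L`, such that `T p` is the tangent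
space of `M` at `p`. -/
structure IsLinearParam (M : Set E) (T : E → Submodule ℝ E) (U : Set F) (φ : F → E)
    (L : E →L[ℝ] F) : Prop where
  isParam : IsParam M U φ
  left_inv : ∀ x ∈ U, L (φ x) = x
  mem_tangent : ∀ x ∈ U, ∀ a, fderiv ℝ φ x a ∈ T (φ x)
  fderiv_apply : ∀ x ∈ U, ∀ X ∈ T (φ x), fderiv ℝ φ x (L X) = X

theorem IsParam.mem {M : Set E} {U : Set F} {φ : F → E} (h : IsParam M U φ) {x : F} (hx : x ∈ U) :
    φ x ∈ M := by
  obtain ⟨W, ψ, -, hW, -⟩ := h.homeo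
  have : φ x ∈ M ∩ W := hW ▸ Set.mem_image_of_mem φ hx
  exact this.1

theorem IsParam.contDiffAt {M : Set E} {U : Set F} {φ : F → E} (h : IsParam M U φ) {x : F}
    (hx : x ∈ U) : ContDiffAt ℝ ∞ φ x :=
  h.smooth.contDiffAt (h.isOpen.mem_nhds hx)

theorem IsParam.contDiffAt_fderiv {M : Set E} {U : Set F} {φ : F → E} (h : IsParam M U φ) {x : F}
    (hx : x ∈ U) : ContDiffAt ℝ ∞ (fderiv ℝ φ) x :=
  (h.contDiffAt hx).fderiv_right (m := ∞) (by simp)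

theorem fderiv_fderiv_apply {φ : F → E} {x : F} (h : DifferentiableAt ℝ (fderiv ℝ φ) x) (a b : F) :
    fderiv ℝ (fun y => fderiv ℝ φ y b) x a = fderiv ℝ (fderiv ℝ φ) x a b := by
  rw [fderiv_clm_apply h (differentiableAt_const b)]
  simp

theorem IsLinearParam.left_inv_fderiv {M : Set E} {T : E → Submodule ℝ E} {U : Set F} {φ : F → E}
    {L : E →L[ℝ] F} (h : IsLinearParam M T U φ L) {x : F} (hx : x ∈ U) (a : F) :
    L (fderiv ℝ φ x a) = a := by
  have h1 := L.hasFDerivAt.comp x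
    ((h.isParam.contDiffAt hx).differentiableAt (by simp)).hasFDerivAt
  have h2 : HasFDerivAt (L ∘ φ) (ContinuousLinearMap.id ℝ F) x :=
    (hasFDerivAt_id x).congr_of_eventuallyEq
      (Filter.eventuallyEq_of_mem (h.isParam.isOpen.mem_nhds hx) h.left_inv)
  exact DFunLike.congr_fun (h1.unique h2) a

/-- A map with a linear left inverse onto a relatively open set is a local parametrization. -/
theorem isParam_of_left_inv {M : Set E} {U : Set F} {φ : F → E} {L : E →L[ℝ] F} {W : Set E}
    (hU : IsOpen U) (hφ : ContDiffOn ℝ ∞ φ U) (hW : IsOpen W) (him : φ '' U = M ∩ W)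
    (hL : ∀ x ∈ U, L (φ x) = x) : IsParam M U φ where
  isOpen := hU
  smooth := hφ
  immersion x hx := by
    have h1 := L.hasFDerivAt.comp x
      ((hφ.contDiffAt (hU.mem_nhds hx)).differentiableAt (by simp)).hasFDerivAt
    have h2 : HasFDerivAt (L ∘ φ) (ContinuousLinearMap.id ℝ F) x :=
      (hasFDerivAt_id x).congr_of_eventuallyEq (Filter.eventuallyEq_of_mem (hU.mem_nhds hx) hL)
    exact Function.LeftInverse.injective (g := L) fun a => DFunLike.congr_fun (h1.unique h2) a
  homeo := ⟨W, L, hW, him, hL, L.continuous.continuousOn⟩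

/-- The covariant derivative `∇_a b = D_a b + Q(a, b)` of coordinate fields. -/
def coordDeriv (φ : F → E) (Q : E → E →L[ℝ] E →L[ℝ] E) (x : F) : F →L[ℝ] F →L[ℝ] E :=
  fderiv ℝ (fderiv ℝ φ) x + (Q (φ x)).bilinearComp (fderiv ℝ φ x) (fderiv ℝ φ x)

theorem coordDeriv_apply (φ : F → E) (Q : E → E →L[ℝ] E →L[ℝ] E) (x a b : F) :
    coordDeriv φ Q x a b =
      fderiv ℝ (fderiv ℝ φ) x a b + Q (φ x) (fderiv ℝ φ x a) (fderiv ℝ φ x b) := rfl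

/-- The Christoffel map of the connection `D + Q` in a parametrization with linear left inverse
`L`. -/
def christoffel (φ : F → E) (L : E →L[ℝ] F) (Q : E → E →L[ℝ] E →L[ℝ] E) (x : F) :
    F →L[ℝ] F →L[ℝ] F :=
  (ContinuousLinearMap.compL ℝ F E F L).comp (coordDeriv φ Q x)

theorem christoffel_apply (φ : F → E) (L : E →L[ℝ] F) (Q : E → E →L[ℝ] E →L[ℝ] E) (x a b : F) :
    christoffel φ L Q x a b = L (coordDeriv φ Q x a b) := rfl

/-- The connection `D + Q` preserves the metric `g` on `M`, and it is torsion free. -/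
structure IsLeviCivita (M : Set E) (T : E → Submodule ℝ E) (s : Set E)
    (g : E → LinearMap.BilinForm ℝ E) (Q : E → E →L[ℝ] E →L[ℝ] E) : Prop where
  isOpen : IsOpen s
  subset : M ⊆ s
  smooth_metric : ∀ B C, ContDiffOn ℝ ∞ (fun q => g q B C) s
  symm_metric : ∀ p ∈ M, ∀ B C, g p B C = g p C B
  smooth : ContDiffOn ℝ ∞ Q s
  symm : ∀ p A B, Q p A B = Q p B A
  compat : ∀ p ∈ M, ∀ A ∈ T p, ∀ B ∈ T p, ∀ C ∈ T p,
    fderiv ℝ (fun q => g q B C) p A = g p (Q p A B) C + g p B (Q p A C)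

/-- The covariant derivatives of coordinate fields are tangent to `M`. -/
def Tangential (T : E → Submodule ℝ E) (U : Set F) (φ : F → E)
    (Q : E → E →L[ℝ] E →L[ℝ] E) : Prop :=
  ∀ x ∈ U, ∀ a b, coordDeriv φ Q x a b ∈ T (φ x)

variable {M : Set E} {T : E → Submodule ℝ E} {U : Set F} {φ : F → E} {L : E →L[ℝ] F} {s : Set E}
  {g : E → LinearMap.BilinForm ℝ E} {Q : E → E →L[ℝ] E →L[ℝ] E}

theorem two_le_infty : (2 : ℕ∞ω) ≤ ∞ :=
  WithTop.coe_le_coe.2 (le_top : (2 : ℕ∞) ≤ ⊤)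

theorem fderiv_symm (hφ : IsParam M U φ) {x : F} (hx : x ∈ U) (a b : F) :
    fderiv ℝ (fderiv ℝ φ) x a b = fderiv ℝ (fderiv ℝ φ) x b a :=
  (hφ.contDiffAt hx).isSymmSndFDerivAt
    (by simpa using two_le_infty) a b

theorem fderiv_fderiv_symm (hφ : IsParam M U φ) {x : F} (hx : x ∈ U) (a b : F) :
    fderiv ℝ (fderiv ℝ (fderiv ℝ φ)) x a b = fderiv ℝ (fderiv ℝ (fderiv ℝ φ)) x b a :=
  (hφ.contDiffAt_fderiv hx).isSymmSndFDerivAt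
    (by simpa using two_le_infty) a b

theorem IsParam.contDiffOn_fderiv (hφ : IsParam M U φ) : ContDiffOn ℝ ∞ (fderiv ℝ φ) U :=
  fun _ hx => (hφ.contDiffAt_fderiv hx).contDiffWithinAt

theorem IsParam.contDiffOn_fderiv_fderiv (hφ : IsParam M U φ) :
    ContDiffOn ℝ ∞ (fderiv ℝ (fderiv ℝ φ)) U :=
  fun _ hx => ((hφ.contDiffAt_fderiv hx).fderiv_right (m := ∞) (by simp)).contDiffWithinAt

theorem coordDeriv_symm (hφ : IsParam M U φ) (hM : IsLeviCivita M T s g Q) {x : F} (hx : x ∈ U)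
    (a b : F) : coordDeriv φ Q x a b = coordDeriv φ Q x b a := by
  rw [coordDeriv_apply, coordDeriv_apply, fderiv_symm hφ hx, hM.symm]

theorem contDiffOn_coordDeriv (hφ : IsParam M U φ) (hM : IsLeviCivita M T s g Q) (b c : F) :
    ContDiffOn ℝ ∞ (fun y => coordDeriv φ Q y b c) U := by
  have h1 : ContDiffOn ℝ ∞ (fun y => Q (φ y)) U :=
    hM.smooth.comp hφ.smooth fun x hx => hM.subset (hφ.mem hx)
  have h2 : ∀ b, ContDiffOn ℝ ∞ (fun y => fderiv ℝ φ y b) U := fun b =>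
    hφ.contDiffOn_fderiv.clm_apply contDiffOn_const
  exact ((hφ.contDiffOn_fderiv_fderiv.clm_apply contDiffOn_const).clm_apply contDiffOn_const).add
    ((h1.clm_apply (h2 b)).clm_apply (h2 c))

theorem fderiv_coordDeriv (hφ : IsParam M U φ) (hM : IsLeviCivita M T s g Q) {x : F}
    (hx : x ∈ U) (a b c : F) :
    fderiv ℝ (fun y => coordDeriv φ Q y b c) x a =
      fderiv ℝ (fderiv ℝ (fderiv ℝ φ)) x a b c
        + fderiv ℝ Q (φ x) (fderiv ℝ φ x a) (fderiv ℝ φ x b) (fderiv ℝ φ x c)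
        + Q (φ x) (fderiv ℝ (fderiv ℝ φ) x a b) (fderiv ℝ φ x c)
        + Q (φ x) (fderiv ℝ φ x b) (fderiv ℝ (fderiv ℝ φ) x a c) := by
  have d1 : HasFDerivAt φ (fderiv ℝ φ x) x :=
    ((hφ.contDiffAt hx).differentiableAt (by simp)).hasFDerivAt
  have d2 : HasFDerivAt (fderiv ℝ φ) (fderiv ℝ (fderiv ℝ φ) x) x :=
    ((hφ.contDiffAt_fderiv hx).differentiableAt (by simp)).hasFDerivAt
  have d3 : HasFDerivAt (fderiv ℝ (fderiv ℝ φ)) (fderiv ℝ (fderiv ℝ (fderiv ℝ φ)) x) x :=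
    ((hφ.contDiffOn_fderiv_fderiv.contDiffAt (hφ.isOpen.mem_nhds hx)).differentiableAt
      (by simp)).hasFDerivAt
  have dQ : HasFDerivAt Q (fderiv ℝ Q (φ x)) (φ x) :=
    ((hM.smooth.contDiffAt (hM.isOpen.mem_nhds (hM.subset (hφ.mem hx)))).differentiableAt
      (by simp)).hasFDerivAt
  have dQφ : HasFDerivAt (fun y => Q (φ y)) ((fderiv ℝ Q (φ x)).comp (fderiv ℝ φ x)) x :=
    HasFDerivAt.comp (g := Q) (G := E →L[ℝ] E →L[ℝ] E) x dQ d1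
  have e2 : ∀ b, HasFDerivAt (fun y => fderiv ℝ φ y b) _ x := fun b =>
    d2.clm_apply (hasFDerivAt_const b x)
  have e3 := (d3.clm_apply (hasFDerivAt_const b x)).clm_apply (hasFDerivAt_const c x)
  have e4 := (dQφ.clm_apply (e2 b)).clm_apply (e2 c)
  have e5 : fderiv ℝ (fun y => coordDeriv φ Q y b c) x = _ := (e3.add e4).fderiv
  rw [e5]
  simp
  abel

variable [FiniteDimensional ℝ E]

theorem contDiffOn_pullback (hφ : IsParam M U φ) (hs : M ⊆ s)
    (hg : ∀ B C, ContDiffOn ℝ ∞ (fun q => g q B C) s) (a b : F) :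
    ContDiffOn ℝ ∞ (fun x => pullback g φ x a b) U := by
  have h : ∀ c, ContDiffOn ℝ ∞ (fun x => fderiv ℝ φ x c) U := fun c =>
    (show ContDiffOn ℝ ∞ (fderiv ℝ φ) U from fun x hx =>
      (hφ.contDiffAt_fderiv hx).contDiffWithinAt).clm_apply contDiffOn_const
  exact contDiffOn_bilinForm hg hφ.smooth (fun x hx => hs (hφ.mem hx)) (h a) (h b)

theorem fderiv_pullback (hφ : IsParam M U φ) (hM : IsLeviCivita M T s g Q) {x : F} (hx : x ∈ U)
    (a b c : F) :
    fderiv ℝ (fun y => pullback g φ y b c) x a =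
      fderiv ℝ (fun q => g q (fderiv ℝ φ x b) (fderiv ℝ φ x c)) (φ x) (fderiv ℝ φ x a)
        + g (φ x) (fderiv ℝ (fderiv ℝ φ) x a b) (fderiv ℝ φ x c)
        + g (φ x) (fderiv ℝ φ x b) (fderiv ℝ (fderiv ℝ φ) x a c) := by
  have hd := (hφ.contDiffAt_fderiv hx).differentiableAt (by simp)
  rw [← fderiv_fderiv_apply hd, ← fderiv_fderiv_apply hd]
  exact fderiv_bilinForm hM.isOpen hM.smooth_metric ((hφ.contDiffAt hx).differentiableAt (by simp))
    (hM.subset (hφ.mem hx)) (hd.clm_apply (differentiableAt_const b))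
    (hd.clm_apply (differentiableAt_const c)) a

/-- Metric compatibility in coordinates: the second derivatives of `φ` from the product rule and the
terms in `Q` from the ambient derivative of `g` add up to covariant derivatives of the coordinate
fields. -/
theorem IsLinearParam.fderiv_pullback (hφ : IsLinearParam M T U φ L)
    (hM : IsLeviCivita M T s g Q) {x : F} (hx : x ∈ U) (a b c : F) :
    fderiv ℝ (fun y => pullback g φ y b c) x a =
      g (φ x) (coordDeriv φ Q x a b) (fderiv ℝ φ x c)
        + g (φ x) (fderiv ℝ φ x b) (coordDeriv φ Q x a c) := by
  rw [ConifoldCone.fderiv_pullback hφ.isParam hM hx, hM.compat _ (hφ.isParam.mem hx) _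
    (hφ.mem_tangent x hx a) _ (hφ.mem_tangent x hx b) _ (hφ.mem_tangent x hx c)]
  simp only [coordDeriv_apply, map_add, LinearMap.add_apply]
  ring

/-- Koszul's argument: compatibility turns the three derivatives into six terms, and symmetry of
`∇_a b` leaves twice one of them. Tangentiality is what lets `L` be undone by the derivative of `φ`.
-/
theorem IsLinearParam.isChristoffel (hφ : IsLinearParam M T U φ L) (hM : IsLeviCivita M T s g Q)
    (hT : Tangential T U φ Q) : IsChristoffel U (pullback g φ) (christoffel φ L Q) := by
  intro x hx a b c
  have hp := hφ.isParam.mem hx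
  have hsymm := coordDeriv_symm hφ.isParam hM hx
  rw [hφ.fderiv_pullback hM hx, hφ.fderiv_pullback hM hx, hφ.fderiv_pullback hM hx]
  simp only [pullback, christoffel_apply, hφ.fderiv_apply x hx _ (hT x hx a b)]
  rw [hsymm b a, hsymm c a, hsymm c b, hM.symm_metric _ hp (fderiv ℝ φ x b),
    hM.symm_metric _ hp (fderiv ℝ φ x a)]
  ring

variable [FiniteDimensional ℝ F]

theorem contDiffOn_christoffel (hφ : IsParam M U φ) (hM : IsLeviCivita M T s g Q) :
    ContDiffOn ℝ ∞ (christoffel φ L Q) U :=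
  contDiffOn_clm_apply.2 fun b => contDiffOn_clm_apply.2 fun c =>
    L.contDiff.comp_contDiffOn (contDiffOn_coordDeriv hφ hM b c)

/-- Differentiating `dφ(Γ(b, c)) = ∇_b c` expresses the derivative of `Γ` through third derivatives
of `φ` and derivatives of `Q`. Antisymmetrizing in `a, b` removes every second and third derivative
of `φ`, leaving the same curvature formula for `Q` in the ambient space. -/
theorem IsLinearParam.fderiv_curvature (hφ : IsLinearParam M T U φ L)
    (hM : IsLeviCivita M T s g Q) (hT : Tangential T U φ Q) {x : F} (hx : x ∈ U) (a b c : F) :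
    fderiv ℝ φ x (curvature (christoffel φ L Q) x b c a) =
      curvature Q (φ x) (fderiv ℝ φ x b) (fderiv ℝ φ x c) (fderiv ℝ φ x a) := by
  have hΓ : ∀ y ∈ U, ∀ b c, fderiv ℝ φ y (christoffel φ L Q y b c) = coordDeriv φ Q y b c :=
    fun y hy b c => hφ.fderiv_apply y hy _ (hT y hy b c)
  have d2 : HasFDerivAt (fderiv ℝ φ) (fderiv ℝ (fderiv ℝ φ) x) x :=
    ((hφ.isParam.contDiffAt_fderiv hx).differentiableAt (by simp)).hasFDerivAt
  have dΓ : HasFDerivAt (christoffel φ L Q) (fderiv ℝ (christoffel φ L Q) x) x :=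
    (((contDiffOn_christoffel hφ.isParam hM).contDiffAt
      (hφ.isParam.isOpen.mem_nhds hx)).differentiableAt (by simp)).hasFDerivAt
  have key : ∀ a b c, fderiv ℝ φ x (fderiv ℝ (christoffel φ L Q) x a b c) =
      fderiv ℝ (fun y => coordDeriv φ Q y b c) x a
        - fderiv ℝ (fderiv ℝ φ) x a (christoffel φ L Q x b c) := by
    intro a b c
    have e1 := d2.clm_apply
      ((dΓ.clm_apply (hasFDerivAt_const b x)).clm_apply (hasFDerivAt_const c x))
    have e2 := (e1.congr_of_eventuallyEq (Filter.eventuallyEq_of_mem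
      (hφ.isParam.isOpen.mem_nhds hx) fun y hy => (hΓ y hy b c).symm)).fderiv
    rw [e2]
    simp
  change fderiv ℝ φ x (fderiv ℝ (christoffel φ L Q) x a b c
    - fderiv ℝ (christoffel φ L Q) x b a c
    + christoffel φ L Q x a (christoffel φ L Q x b c)
    - christoffel φ L Q x b (christoffel φ L Q x a c)) = _
  rw [map_sub, map_add, map_sub, hΓ x hx, hΓ x hx, key, key, fderiv_coordDeriv hφ.isParam hM hx,
    fderiv_coordDeriv hφ.isParam hM hx, fderiv_fderiv_symm hφ.isParam hx a b,
    fderiv_symm hφ.isParam hx b a, coordDeriv_apply φ Q x a (christoffel φ L Q x b c),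
    coordDeriv_apply φ Q x b (christoffel φ L Q x a c), hΓ x hx, hΓ x hx,
    coordDeriv_apply, coordDeriv_apply]
  simp only [curvature, LinearMap.coe_mk, AddHom.coe_mk, map_add]
  abel

/-- The Ricci tensor is the trace of the curvature of `D + Q` on the tangent space. -/
theorem IsLinearParam.ricci_eq (hφ : IsLinearParam M T U φ L)
    (hM : IsLeviCivita M T s g Q) (hT : Tangential T U φ Q) {x : F} (hx : x ∈ U) (b c : F)
    (P : E →ₗ[ℝ] E) (hP : ∀ X, P X ∈ T (φ x)) (hPT : ∀ X ∈ T (φ x), P X = X) :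
    ricci (christoffel φ L Q) x b c =
      LinearMap.trace ℝ E (curvature Q (φ x) (fderiv ℝ φ x b) (fderiv ℝ φ x c) ∘ₗ P) := by
  let D : F →ₗ[ℝ] E := fderiv ℝ φ x
  let L' : E →ₗ[ℝ] F := L
  let R := curvature (christoffel φ L Q) x b c
  -- The chart curvature and the ambient one composed with `P` are the two products of the same pair
  -- of maps, so `tr (fg) = tr (gf)` identifies their traces although they live on different spaces.
  have h1 : R = (L' ∘ₗ P) ∘ₗ (D ∘ₗ R) := by
    ext a
    change R a = L (P (fderiv ℝ φ x (R a)))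
    rw [hPT _ (hφ.mem_tangent x hx _), hφ.left_inv_fderiv hx]
  have h2 : curvature Q (φ x) (fderiv ℝ φ x b) (fderiv ℝ φ x c) ∘ₗ P
      = (D ∘ₗ R) ∘ₗ (L' ∘ₗ P) := by
    ext X
    change _ = fderiv ℝ φ x (R (L (P X)))
    rw [hφ.fderiv_curvature hM hT hx, hφ.fderiv_apply x hx _ (hP X)]
    rfl
  rw [h2, LinearMap.trace_comp_comm', ← h1]
  rfl

end Connection

/-! ### Transport of metrics and Kähler structures along diffeomorphisms -/

section Transport

variable {E E' F : Type*} [NormedAddCommGroup E] [NormedSpace ℝ E]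
  [NormedAddCommGroup E'] [NormedSpace ℝ E'] [NormedAddCommGroup F] [NormedSpace ℝ F]
  {M : Set E} {N : Set E'} {U : Set F} {φ : F → E} {Ψ : E → E'} {Ξ : E' → E}

theorem IsParam.fderiv_mem_tangentVectors (hφ : IsParam M U φ) {x : F} (hx : x ∈ U) (a : F) :
    fderiv ℝ φ x a ∈ tangentVectors M (φ x) := by
  have hl : HasDerivAt (fun s : ℝ => x + s • a) a 0 := by
    simpa using ((hasDerivAt_id (0 : ℝ)).smul_const a).const_add x
  have hφd : HasFDerivAt φ (fderiv ℝ φ x) (x + (0 : ℝ) • a) := by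
    simpa using ((hφ.contDiffAt hx).differentiableAt (by simp)).hasFDerivAt
  refine ⟨fun s => φ (x + s • a), by simp, ?_, hφd.comp_hasDerivAt 0 hl⟩
  have h0 : U ∈ 𝓝 (x + (0 : ℝ) • a) := by simpa using hφ.isOpen.mem_nhds hx
  exact (hl.continuousAt.eventually h0).mono fun s hs => hφ.mem hs

/-- `Ξ` is a smooth left inverse on `N` of the smooth map `Ψ : M → N`. -/
structure IsDiffeoWith (M : Set E) (N : Set E') (Ψ : E → E') (Ξ : E' → E) : Prop where
  bijOn : Set.BijOn Ψ M N
  leftInvOn : Set.LeftInvOn Ξ Ψ M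
  smooth : ∃ V, IsOpen V ∧ M ⊆ V ∧ ContDiffOn ℝ ∞ Ψ V
  smooth_inv : ∃ V, IsOpen V ∧ N ⊆ V ∧ ContDiffOn ℝ ∞ Ξ V

theorem IsDiffeoWith.contDiffAt (h : IsDiffeoWith M N Ψ Ξ) {p : E} (hp : p ∈ M) :
    ContDiffAt ℝ ∞ Ψ p := by
  obtain ⟨V, hV, hMV, hΨ⟩ := h.smooth
  exact hΨ.contDiffAt (hV.mem_nhds (hMV hp))

theorem IsDiffeoWith.contDiffAt_inv (h : IsDiffeoWith M N Ψ Ξ) {q : E'} (hq : q ∈ N) :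
    ContDiffAt ℝ ∞ Ξ q := by
  obtain ⟨V, hV, hNV, hΞ⟩ := h.smooth_inv
  exact hΞ.contDiffAt (hV.mem_nhds (hNV hq))

theorem IsDiffeoWith.fderiv_comp (h : IsDiffeoWith M N Ψ Ξ) (hφ : IsParam M U φ) {x : F}
    (hx : x ∈ U) (a : F) :
    fderiv ℝ (Ψ ∘ φ) x a = fderiv ℝ Ψ (φ x) (fderiv ℝ φ x a) := by
  rw [_root_.fderiv_comp x ((h.contDiffAt (hφ.mem hx)).differentiableAt (by simp))
    ((hφ.contDiffAt hx).differentiableAt (by simp))]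
  rfl

/-- `Ξ ∘ Ψ` is the identity only on `M`, not near it, so the chain rule is applied to `Ξ ∘ Ψ ∘ φ =
φ`, which holds on an open set. -/
theorem IsDiffeoWith.fderiv_inv_fderiv (h : IsDiffeoWith M N Ψ Ξ) (hφ : IsParam M U φ) {x : F}
    (hx : x ∈ U) (a : F) :
    fderiv ℝ Ξ (Ψ (φ x)) (fderiv ℝ Ψ (φ x) (fderiv ℝ φ x a)) = fderiv ℝ φ x a := by
  have hp := hφ.mem hx
  have d1 := (((h.contDiffAt hp).differentiableAt (by simp)).hasFDerivAt).comp x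
    ((hφ.contDiffAt hx).differentiableAt (by simp)).hasFDerivAt
  have d2 := (((h.contDiffAt_inv (h.bijOn.mapsTo hp)).differentiableAt
    (by simp)).hasFDerivAt).comp x d1
  have d3 := d2.congr_of_eventuallyEq (f₁ := φ) (Filter.eventuallyEq_of_mem
    (hφ.isOpen.mem_nhds hx) fun y hy => (h.leftInvOn (hφ.mem hy)).symm)
  exact (DFunLike.congr_fun d3.fderiv a).symm

theorem IsParam.comp_diffeo (hφ : IsParam M U φ) (h : IsDiffeoWith M N Ψ Ξ) :
    IsParam N U (Ψ ∘ φ) where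
  isOpen := hφ.isOpen
  smooth x hx := ((h.contDiffAt (hφ.mem hx)).comp x (hφ.contDiffAt hx)).contDiffWithinAt
  immersion x hx a b hab := by
    rw [h.fderiv_comp hφ hx, h.fderiv_comp hφ hx] at hab
    have h1 := congrArg (fderiv ℝ Ξ (Ψ (φ x))) hab
    rw [h.fderiv_inv_fderiv hφ hx, h.fderiv_inv_fderiv hφ hx] at h1
    exact hφ.immersion x hx h1
  homeo := by
    obtain ⟨W, ψ, hW, him, hinv, hψ⟩ := hφ.homeo
    obtain ⟨V, hV, hNV, hΞ⟩ := h.smooth_inv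
    have himg : (Ψ ∘ φ) '' U = N ∩ (V ∩ Ξ ⁻¹' W) := by
      rw [Set.image_comp, him]
      ext q
      constructor
      · rintro ⟨p, ⟨hp, hpW⟩, rfl⟩
        have hN := h.bijOn.mapsTo hp
        exact ⟨hN, hNV hN, by rwa [Set.mem_preimage, h.leftInvOn hp]⟩
      · rintro ⟨hq, -, hqW⟩
        obtain ⟨p, hp, rfl⟩ := h.bijOn.surjOn hq
        rw [Set.mem_preimage, h.leftInvOn hp] at hqW
        exact ⟨p, ⟨hp, hqW⟩, rfl⟩
    refine ⟨V ∩ Ξ ⁻¹' W, ψ ∘ Ξ, hΞ.continuousOn.isOpen_inter_preimage hV hW, himg, ?_, ?_⟩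
    · intro x hx
      simp only [Function.comp_apply]
      rw [h.leftInvOn (hφ.mem hx), hinv hx]
    · refine hψ.comp (hΞ.continuousOn.mono fun q hq => hq.2.1) ?_
      rintro q ⟨hq, -, hqW⟩
      obtain ⟨p, hp, rfl⟩ := h.bijOn.surjOn hq
      rw [Set.mem_preimage] at hqW
      rw [h.leftInvOn hp] at hqW ⊢
      exact ⟨hp, hqW⟩

variable {g : E → LinearMap.BilinForm ℝ E} {k : E' → LinearMap.BilinForm ℝ E'}

theorem pullback_comp_diffeo (hφ : IsParam M U φ) (h : IsDiffeoWith M N Ψ Ξ)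
    (hk : PullsBackTo M g k Ψ) {x : F} (hx : x ∈ U) (a b : F) :
    pullback k (Ψ ∘ φ) x a b = pullback g φ x a b := by
  rw [pullback, h.fderiv_comp hφ hx, h.fderiv_comp hφ hx]
  exact hk _ (hφ.mem hx) _ (hφ.fderiv_mem_tangentVectors hx a) _
    (hφ.fderiv_mem_tangentVectors hx b)

theorem IsRiemannianMetric.of_diffeo (hM : IsRiemannianMetric F M g) (h : IsDiffeoWith M N Ψ Ξ)
    (hk : PullsBackTo M g k Ψ) : IsRiemannianMetric F N k := by
  intro q hq
  obtain ⟨p, hp, rfl⟩ := h.bijOn.surjOn hq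
  obtain ⟨U, φ, hφ, hpU, hs, hsymm, hpos⟩ := hM p hp
  have key : ∀ x ∈ U, ∀ a b, pullback k (Ψ ∘ φ) x a b = pullback g φ x a b :=
    fun x hx => pullback_comp_diffeo hφ h hk hx
  refine ⟨U, Ψ ∘ φ, hφ.comp_diffeo h, ?_, fun a b => (hs a b).congr fun x hx => key x hx a b,
    fun x hx a b => by rw [key x hx, key x hx, hsymm x hx],
    fun x hx a ha => by rw [key x hx]; exact hpos x hx a ha⟩
  rw [Set.image_comp]
  exact Set.mem_image_of_mem Ψ hpU

/-- The charts of `N` are those of `M` followed by `Ψ`; they pull back the same coefficients, so the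
Hermitian and closedness conditions carry over verbatim. The conjugated `J` matters only on tangent
vectors, where `dΞ` undoes `dΨ`. -/
theorem IsKahler.of_diffeo {n : ℕ} {J : E → E →ₗ[ℝ] E} (hM : IsKahler n M J g)
    (h : IsDiffeoWith M N Ψ Ξ) (hk : PullsBackTo M g k Ψ) :
    IsKahler n N (fun q => (fderiv ℝ Ψ (Ξ q) : E →ₗ[ℝ] E') ∘ₗ J (Ξ q) ∘ₗ
      (fderiv ℝ Ξ q : E' →ₗ[ℝ] E)) k := by
  refine ⟨hM.1.of_diffeo h hk, ?_⟩
  intro q hq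
  obtain ⟨p, hp, rfl⟩ := h.bijOn.surjOn hq
  obtain ⟨U, φ, hφ, hpU, hJ, hherm, hclosed⟩ := hM.2 p hp
  have key : ∀ x ∈ U, ∀ a b, pullback k (Ψ ∘ φ) x a b = pullback g φ x a b :=
    fun x hx => pullback_comp_diffeo hφ h hk hx
  have keyd : ∀ x ∈ U, ∀ a b, fderiv ℝ (fun y => pullback k (Ψ ∘ φ) y a b) x =
      fderiv ℝ (fun y => pullback g φ y a b) x := fun x hx a b =>
    (Filter.eventuallyEq_of_mem (hφ.isOpen.mem_nhds hx) fun y hy => key y hy a b).fderiv_eq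
  refine ⟨U, Ψ ∘ φ, hφ.comp_diffeo h, ?_, ?_, ?_, ?_⟩
  · rw [Set.image_comp]
    exact Set.mem_image_of_mem Ψ hpU
  · intro x hx a
    simp only [h.fderiv_comp hφ hx, hJ x hx, Function.comp_apply, LinearMap.coe_comp,
      ContinuousLinearMap.coe_coe, h.fderiv_inv_fderiv hφ hx, h.leftInvOn (hφ.mem hx)]
  · intro x hx a b
    rw [key x hx, key x hx, hherm x hx]
  · intro x hx a b c
    rw [keyd x hx, keyd x hx, keyd x hx, hclosed x hx]

end Transport

/-! ### Quadrics: charts, tangent spaces and tangential connections -/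

section Quadric

variable {E F G : Type*} [NormedAddCommGroup E] [NormedSpace ℝ E]
  [NormedAddCommGroup F] [NormedSpace ℝ F] [NormedAddCommGroup G] [NormedSpace ℝ G]
  {M : Set E} {T : E → Submodule ℝ E} {U : Set F} {φ : F → E} {L : E →L[ℝ] F}
  {Q : E → E →L[ℝ] E →L[ℝ] E} {β : E →L[ℝ] E →L[ℝ] G}

/-- Reduces each explicit derivative below to a one-variable computation along a line. -/
theorem fderiv_eq_of_line {f : E → G} {p A : E} {d : G} (hf : DifferentiableAt ℝ f p)
    (h : HasDerivAt (fun s : ℝ => f (p + s • A)) d 0) : fderiv ℝ f p A = d := by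
  have hl : HasDerivAt (fun s : ℝ => p + s • A) A 0 := by
    simpa using ((hasDerivAt_id (0 : ℝ)).smul_const A).const_add p
  have hf' : HasFDerivAt f (fderiv ℝ f p) (p + (0 : ℝ) • A) := by simpa using hf.hasFDerivAt
  exact (hf'.comp_hasDerivAt 0 hl).unique h

/-- A parametrization with a linear left inverse of a part of the quadric `β q q = k`. -/
theorem isLinearParam_of_quadric {k : G} {W : Set E} (hβ : ∀ A B, β A B = β B A)
    (hM : ∀ q ∈ M, β q q = k) (hT : ∀ p X, X ∈ T p ↔ β p X = 0) (hU : IsOpen U)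
    (hφ : ContDiffOn ℝ ∞ φ U) (hW : IsOpen W) (him : φ '' U = M ∩ W)
    (hL : ∀ x ∈ U, L (φ x) = x) (hd : ∀ x ∈ U, ∀ X, β (φ x) X = 0 → fderiv ℝ φ x (L X) = X) :
    IsLinearParam M T U φ L where
  isParam := isParam_of_left_inv hU hφ hW him hL
  left_inv := hL
  mem_tangent x hx a := by
    have hp := isParam_of_left_inv hU hφ hW him hL
    have d1 := ((hp.contDiffAt hx).differentiableAt (by simp)).hasFDerivAt
    have d2 := (β.hasFDerivAt.comp x d1).clm_apply d1
    have d3 : HasFDerivAt (fun y => β (φ y) (φ y)) (0 : F →L[ℝ] G) x :=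
      (hasFDerivAt_const k x).congr_of_eventuallyEq
        (Filter.eventuallyEq_of_mem (hU.mem_nhds hx) fun y hy => hM _ (hp.mem hy))
    have h := DFunLike.congr_fun (d2.unique d3) a
    simp only [Function.comp_apply, add_apply, ContinuousLinearMap.comp_apply,
      ContinuousLinearMap.flip_apply, zero_apply] at h
    rw [hβ (fderiv ℝ φ x a), ← two_smul ℝ, smul_eq_zero] at h
    exact (hT _ _).2 (h.resolve_left two_ne_zero)
  fderiv_apply x hx X hX := hd x hx X ((hT _ _).1 hX)

/-- On a quadric, `∇ = D + Q` preserves the tangent spaces if the normal component of `Q` is the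
second fundamental form. -/
theorem tangential_of_quadric (hφ : IsLinearParam M T U φ L) (hT : ∀ p X, X ∈ T p ↔ β p X = 0)
    (hQ : ∀ p ∈ M, ∀ A ∈ T p, ∀ B ∈ T p, β p (Q p A B) = β A B) : Tangential T U φ Q := by
  intro x hx a b
  have d1 := ((hφ.isParam.contDiffAt hx).differentiableAt (by simp)).hasFDerivAt
  have d2 := ((hφ.isParam.contDiffAt_fderiv hx).differentiableAt (by simp)).hasFDerivAt
  have d3 := (β.hasFDerivAt.comp x d1).clm_apply (d2.clm_apply (hasFDerivAt_const b x))
  have d4 : HasFDerivAt (fun y => β (φ y) (fderiv ℝ φ y b)) (0 : F →L[ℝ] G) x :=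
    (hasFDerivAt_const 0 x).congr_of_eventuallyEq
      (Filter.eventuallyEq_of_mem (hφ.isParam.isOpen.mem_nhds hx) fun y hy =>
        (hT _ _).1 (hφ.mem_tangent y hy b))
  have h := DFunLike.congr_fun (d3.unique d4) a
  simp only [Function.comp_apply, add_apply, ContinuousLinearMap.comp_apply,
    ContinuousLinearMap.flip_apply, zero_apply, map_zero, zero_add] at h
  rw [hT, coordDeriv_apply, map_add, hQ _ (hφ.isParam.mem hx) _ (hφ.mem_tangent x hx a) _
    (hφ.mem_tangent x hx b), h]

end Quadric

/-! ### Criteria for Riemannian, Kähler and Einstein metrics -/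

section Kahler

variable {E : Type*} [NormedAddCommGroup E] [NormedSpace ℝ E] [FiniteDimensional ℝ E] {M s : Set E}
  {T : E → Submodule ℝ E} {g : E → LinearMap.BilinForm ℝ E} {Q : E → E →L[ℝ] E →L[ℝ] E}

theorem isRiemannianMetric_of_isLinearParam {F : Type*} [NormedAddCommGroup F] [NormedSpace ℝ F]
    (hM : IsLeviCivita M T s g Q)
    (hpos : ∀ p ∈ M, ∀ X ∈ T p, X ≠ 0 → 0 < g p X X)
    (hpar : ∀ p ∈ M, ∃ (U : Set F) (φ : F → E) (L : E →L[ℝ] F),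
      IsLinearParam M T U φ L ∧ p ∈ φ '' U) : IsRiemannianMetric F M g := by
  intro p hp
  obtain ⟨U, φ, L, hφ, hpU⟩ := hpar p hp
  refine ⟨U, φ, hφ.isParam, hpU,
    contDiffOn_pullback hφ.isParam hM.subset hM.smooth_metric,
    fun x hx a b => hM.symm_metric _ (hφ.isParam.mem hx) _ _, fun x hx a ha =>
    hpos _ (hφ.isParam.mem hx) _ (hφ.mem_tangent x hx a) fun h0 => ha ?_⟩
  rw [← hφ.left_inv_fderiv hx a, h0, map_zero]

/-- A Hermitian metric is Kähler if its Levi-Civita connection `D + Q` is complex linear. -/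
theorem isKahler_of_isLinearParam {n : ℕ} {J : E →L[ℝ] E}
    (hM : IsLeviCivita M T s g Q) (hpos : ∀ p ∈ M, ∀ X ∈ T p, X ≠ 0 → 0 < g p X X)
    (hJ : ∀ A, J (J A) = -A)
    (hherm : ∀ p ∈ M, ∀ A B, g p (J A) (J B) = g p A B)
    (hQ : ∀ p A B, Q p A (J B) = J (Q p A B))
    (hpar : ∀ p ∈ M, ∃ (U : Set (Fin n → ℂ)) (φ : (Fin n → ℂ) → E) (L : E →L[ℝ] (Fin n → ℂ)),
      IsLinearParam M T U φ L ∧ Tangential T U φ Q ∧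
      (∀ x ∈ U, ∀ a, fderiv ℝ φ x (Complex.I • a) = J (fderiv ℝ φ x a)) ∧ p ∈ φ '' U) :
    IsKahler n M (fun _ => J) g := by
  refine ⟨isRiemannianMetric_of_isLinearParam hM hpos fun p hp => ?_, fun p hp => ?_⟩
  · obtain ⟨U, φ, L, hφ, -, -, hpU⟩ := hpar p hp
    exact ⟨U, φ, L, hφ, hpU⟩
  obtain ⟨U, φ, L, hφ, hT, hφJ, hpU⟩ := hpar p hp
  refine ⟨U, φ, hφ.isParam, hpU, hφJ, ?_, ?_⟩
  · intro x hx a b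
    rw [pullback, hφJ x hx, hφJ x hx, hherm _ (hφ.isParam.mem hx), pullback]
  · intro x hx a b c
    have hp := hφ.isParam.mem hx
    -- This is `∇J = 0`: `J` is constant on `E`, commutes with the derivative of the chart, and
    -- commutes with `Q` in its second argument.
    have hN : ∀ a b, coordDeriv φ Q x a (Complex.I • b) = J (coordDeriv φ Q x a b) := by
      intro a b
      have d2 := ((hφ.isParam.contDiffAt_fderiv hx).differentiableAt (by simp))
      have h1 : fderiv ℝ (fun y => fderiv ℝ φ y (Complex.I • b)) x a
          = J (fderiv ℝ (fun y => fderiv ℝ φ y b) x a) := by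
        have e1 := J.hasFDerivAt.comp x (d2.clm_apply (differentiableAt_const b)).hasFDerivAt
        have e2 := e1.congr_of_eventuallyEq (f₁ := fun y => fderiv ℝ φ y (Complex.I • b))
          (Filter.eventuallyEq_of_mem (hφ.isParam.isOpen.mem_nhds hx) fun y hy => hφJ y hy b)
        rw [e2.fderiv]
        rfl
      rw [fderiv_fderiv_apply d2, fderiv_fderiv_apply d2] at h1
      rw [coordDeriv_apply, coordDeriv_apply, h1, hφJ x hx, hQ, map_add]
    -- Skewness of the fundamental form: together with the symmetry of `∇_a b` it makes the six
    -- terms of the cyclic sum cancel in pairs.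
    have hJg : ∀ A B, g (φ x) (J A) B = -g (φ x) (J B) A := by
      intro A B
      rw [← hherm _ hp (J A) B, hJ, map_neg, LinearMap.neg_apply, hM.symm_metric _ hp A]
    have hsymm := coordDeriv_symm hφ.isParam hM hx
    rw [hφ.fderiv_pullback hM hx, hφ.fderiv_pullback hM hx, hφ.fderiv_pullback hM hx]
    simp only [hN, hφJ x hx]
    rw [hJg (coordDeriv φ Q x a b), hJg (coordDeriv φ Q x b c), hJg (coordDeriv φ Q x c a),
      hsymm b a, hsymm c b, hsymm c a]
    ring

theorem isEinstein_of_isLinearParam {F : Type*} [NormedAddCommGroup F] [NormedSpace ℝ F]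
    [FiniteDimensional ℝ F] (hM : IsLeviCivita M T s g Q) {lam : ℝ} (P : E → E →ₗ[ℝ] E)
    (hP : ∀ p ∈ M, ∀ X, P p X ∈ T p) (hPT : ∀ p ∈ M, ∀ X ∈ T p, P p X = X)
    (hpar : ∀ p ∈ M, ∃ (U : Set F) (φ : F → E) (L : E →L[ℝ] F),
      IsLinearParam M T U φ L ∧ Tangential T U φ Q ∧ p ∈ φ '' U)
    (hric : ∀ p ∈ M, ∀ B ∈ T p, ∀ C ∈ T p,
      LinearMap.trace ℝ E (curvature Q p B C ∘ₗ P p) = lam * g p B C) :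
    IsEinstein F M g lam := by
  intro p hp
  obtain ⟨U, φ, L, hφ, hT, x, hx, rfl⟩ := hpar p hp
  refine ⟨U, φ, x, christoffel φ L Q, hφ.isParam, hx, rfl, hφ.isChristoffel hM hT, fun b c => ?_⟩
  rw [hφ.ricci_eq hM hT hx b c (P (φ x)) (hP _ hp) (hPT _ hp),
    hric _ hp _ (hφ.mem_tangent x hx b) _ (hφ.mem_tangent x hx c), pullback]

end Kahler

/-! ### The connection of the unit conormal bundle -/

section Link

open LinearMap (toContinuousBilinearMap)

variable {ι : Type*}

/-- The complex structure `(X₁, X₂) ↦ (-X₂, X₁)`. -/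
def rot : ((ι → ℝ) × (ι → ℝ)) →ₗ[ℝ] ((ι → ℝ) × (ι → ℝ)) where
  toFun X := (-X.2, X.1)
  map_add' X Y := by ext <;> simp; ring
  map_smul' c X := by ext <;> simp

theorem rot_apply (X : (ι → ℝ) × (ι → ℝ)) : rot X = (-X.2, X.1) := rfl

variable [Fintype ι]

/-- The constraints `(X₁ · Y₁, X₂ · Y₂, X₁ · Y₂ + X₂ · Y₁)`, which define the unit conormal bundle
as the quadric where they take the value `(1, 1, 0)` at `X = Y`. -/
def linkForm (ι : Type*) [Fintype ι] :
    ((ι → ℝ) × (ι → ℝ)) →L[ℝ] ((ι → ℝ) × (ι → ℝ)) →L[ℝ] ℝ × ℝ × ℝ :=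
  toContinuousBilinearMap <| LinearMap.mk₂ ℝ
    (fun X Y => (X.1 ⬝ᵥ Y.1, X.2 ⬝ᵥ Y.2, X.1 ⬝ᵥ Y.2 + X.2 ⬝ᵥ Y.1))
    (by intros; ext <;> simp [add_dotProduct]; ring)
    (by intros; ext <;> simp; ring)
    (by intros; ext <;> simp [dotProduct_add]; ring)
    (by intros; ext <;> simp; ring)

theorem linkForm_apply (X Y : (ι → ℝ) × (ι → ℝ)) :
    linkForm ι X Y = (X.1 ⬝ᵥ Y.1, X.2 ⬝ᵥ Y.2, X.1 ⬝ᵥ Y.2 + X.2 ⬝ᵥ Y.1) := rfl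

theorem linkForm_symm (X Y : (ι → ℝ) × (ι → ℝ)) : linkForm ι X Y = linkForm ι Y X := by
  simp only [linkForm_apply, dotProduct_comm Y.1, dotProduct_comm Y.2, add_comm]

/-- The tangent spaces of the unit conormal bundle. -/
def linkTangent (p : (ι → ℝ) × (ι → ℝ)) : Submodule ℝ ((ι → ℝ) × (ι → ℝ)) :=
  LinearMap.ker (linkForm ι p : ((ι → ℝ) × (ι → ℝ)) →ₗ[ℝ] ℝ × ℝ × ℝ)

theorem mem_linkTangent {p X : (ι → ℝ) × (ι → ℝ)} : X ∈ linkTangent p ↔ linkForm ι p X = 0 :=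
  Iff.rfl

theorem mem_linkTangent_iff {p X : (ι → ℝ) × (ι → ℝ)} :
    X ∈ linkTangent p ↔ p.1 ⬝ᵥ X.1 = 0 ∧ p.2 ⬝ᵥ X.2 = 0 ∧ p.2 ⬝ᵥ X.1 = -(p.1 ⬝ᵥ X.2) := by
  rw [mem_linkTangent, linkForm_apply]
  simp only [Prod.mk_eq_zero]
  constructor <;> rintro ⟨h1, h2, h3⟩ <;> exact ⟨h1, h2, by linarith⟩

/-- The Christoffel symbols of the metric `|dû|² + |dv̂|² - 2κ (û · dv̂)²`. -/
def linkConnection (κ : ℝ) (p : (ι → ℝ) × (ι → ℝ)) :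
    ((ι → ℝ) × (ι → ℝ)) →L[ℝ] ((ι → ℝ) × (ι → ℝ)) →L[ℝ] ((ι → ℝ) × (ι → ℝ)) :=
  toContinuousBilinearMap <| LinearMap.mk₂ ℝ
    (fun X Y => (X.1 ⬝ᵥ Y.1) • (p.1, 0) + (X.2 ⬝ᵥ Y.2) • (0, p.2)
      + (2⁻¹ * (X.1 ⬝ᵥ Y.2 + X.2 ⬝ᵥ Y.1)) • (p.2, p.1)
      - κ • ((p.1 ⬝ᵥ Y.2) • rot X + (p.1 ⬝ᵥ X.2) • rot Y
        + (2 * (p.1 ⬝ᵥ X.2) * (p.1 ⬝ᵥ Y.2)) • p))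
    (by intros; ext <;> simp [add_dotProduct, dotProduct_add] <;> ring)
    (by intros; ext <;> simp <;> ring)
    (by intros; ext <;> simp [dotProduct_add] <;> ring)
    (by intros; ext <;> simp <;> ring)

theorem linkConnection_apply (κ : ℝ) (p X Y : (ι → ℝ) × (ι → ℝ)) :
    linkConnection κ p X Y = (X.1 ⬝ᵥ Y.1) • (p.1, 0) + (X.2 ⬝ᵥ Y.2) • (0, p.2)
      + (2⁻¹ * (X.1 ⬝ᵥ Y.2 + X.2 ⬝ᵥ Y.1)) • (p.2, p.1)
      - κ • ((p.1 ⬝ᵥ Y.2) • rot X + (p.1 ⬝ᵥ X.2) • rot Y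
        + (2 * (p.1 ⬝ᵥ X.2) * (p.1 ⬝ᵥ Y.2)) • p) := rfl

theorem linkConnection_symm (κ : ℝ) (p X Y : (ι → ℝ) × (ι → ℝ)) :
    linkConnection κ p X Y = linkConnection κ p Y X := by
  rw [linkConnection_apply, linkConnection_apply, dotProduct_comm Y.1, dotProduct_comm Y.2,
    dotProduct_comm Y.1 X.2, dotProduct_comm Y.2]
  ext <;> simp <;> ring

theorem contDiff_linkConnection (κ : ℝ) : ContDiff ℝ ∞ (linkConnection (ι := ι) κ) := by
  refine contDiff_clm_apply_iff.2 fun X => contDiff_clm_apply_iff.2 fun Y => ?_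
  simp only [linkConnection_apply, dotProduct]
  fun_prop

/-- For polynomial functions on a line the derivative at 0 is the linear coefficient; degree three
is the highest that occurs, in the term `η(X) η(Y) p` of `linkConnection`. -/
theorem hasDerivAt_of_eq_cubic {E : Type*} [NormedAddCommGroup E] [NormedSpace ℝ E] {f : ℝ → E}
    {v₀ v₁ v₂ v₃ : E} (h : ∀ s, f s = v₀ + s • v₁ + s ^ 2 • v₂ + s ^ 3 • v₃) :
    HasDerivAt f v₁ 0 := by
  rw [funext h]
  have h1 := (((hasDerivAt_id (0 : ℝ)).smul_const v₁).const_add v₀).add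
    (((hasDerivAt_id (0 : ℝ)).pow 2).smul_const v₂)
  have h2 := h1.add (((hasDerivAt_id (0 : ℝ)).pow 3).smul_const v₃)
  exact h2.congr_deriv (by simp)

theorem fderiv_linkConnection (κ : ℝ) (p A X Y : (ι → ℝ) × (ι → ℝ)) :
    fderiv ℝ (linkConnection κ) p A X Y =
      (X.1 ⬝ᵥ Y.1) • (A.1, 0) + (X.2 ⬝ᵥ Y.2) • (0, A.2)
      + (2⁻¹ * (X.1 ⬝ᵥ Y.2 + X.2 ⬝ᵥ Y.1)) • (A.2, A.1)
      - κ • ((A.1 ⬝ᵥ Y.2) • rot X + (A.1 ⬝ᵥ X.2) • rot Y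
        + (2 * ((A.1 ⬝ᵥ X.2) * (p.1 ⬝ᵥ Y.2) + (p.1 ⬝ᵥ X.2) * (A.1 ⬝ᵥ Y.2))) • p
        + (2 * (p.1 ⬝ᵥ X.2) * (p.1 ⬝ᵥ Y.2)) • A) := by
  have hd : HasFDerivAt (linkConnection (ι := ι) κ) (fderiv ℝ (linkConnection κ) p) p :=
    ((contDiff_linkConnection κ).differentiable (by simp) p).hasFDerivAt
  have h1 := (hd.clm_apply (hasFDerivAt_const X p)).clm_apply (hasFDerivAt_const Y p)
  have h2 : fderiv ℝ (linkConnection κ) p A X Y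
      = fderiv ℝ (fun q => linkConnection κ q X Y) p A := by
    rw [h1.fderiv]; simp
  rw [h2]
  refine fderiv_eq_of_line h1.differentiableAt (hasDerivAt_of_eq_cubic
    (v₀ := linkConnection κ p X Y)
    (v₂ := -(2 * κ) • ((A.1 ⬝ᵥ X.2 * A.1 ⬝ᵥ Y.2) • p
      + ((A.1 ⬝ᵥ X.2) * (p.1 ⬝ᵥ Y.2) + (p.1 ⬝ᵥ X.2) * (A.1 ⬝ᵥ Y.2)) • A))
    (v₃ := -(2 * κ) • ((A.1 ⬝ᵥ X.2 * A.1 ⬝ᵥ Y.2) • A)) fun s => ?_)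
  simp only [linkConnection_apply]
  ext <;> simp [add_dotProduct] <;> ring

end Link

/-! ### Ricci tensor of the unit conormal bundle by explicit traces -/

section LinkRicci

variable {ι : Type*}

/-- The diagonal blocks and the swap of a product. -/
def blockFst : ((ι → ℝ) × (ι → ℝ)) →ₗ[ℝ] ((ι → ℝ) × (ι → ℝ)) :=
  LinearMap.inl ℝ _ _ ∘ₗ LinearMap.fst ℝ _ _

def blockSnd : ((ι → ℝ) × (ι → ℝ)) →ₗ[ℝ] ((ι → ℝ) × (ι → ℝ)) :=
  LinearMap.inr ℝ _ _ ∘ₗ LinearMap.snd ℝ _ _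

def blockSwap : ((ι → ℝ) × (ι → ℝ)) →ₗ[ℝ] ((ι → ℝ) × (ι → ℝ)) :=
  (LinearMap.snd ℝ _ _).prod (LinearMap.fst ℝ _ _)

theorem blockFst_apply (X : (ι → ℝ) × (ι → ℝ)) : blockFst X = (X.1, 0) := rfl
theorem blockSnd_apply (X : (ι → ℝ) × (ι → ℝ)) : blockSnd X = (0, X.2) := rfl
theorem blockSwap_apply (X : (ι → ℝ) × (ι → ℝ)) : blockSwap X = (X.2, X.1) := rfl

variable [Fintype ι]

/-- The rank one map `X ↦ (q₁ · X₁ + q₂ · X₂) V`. -/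
def rankOne (q V : (ι → ℝ) × (ι → ℝ)) : ((ι → ℝ) × (ι → ℝ)) →ₗ[ℝ] ((ι → ℝ) × (ι → ℝ)) where
  toFun X := (q.1 ⬝ᵥ X.1 + q.2 ⬝ᵥ X.2) • V
  map_add' X Y := by simp only [Prod.fst_add, Prod.snd_add, dotProduct_add, ← add_smul]; ring_nf
  map_smul' c X := by simp [← mul_smul, mul_add]

theorem rankOne_apply (q V X : (ι → ℝ) × (ι → ℝ)) :
    rankOne q V X = (q.1 ⬝ᵥ X.1 + q.2 ⬝ᵥ X.2) • V := rfl

theorem trace_rankOne (q V : (ι → ℝ) × (ι → ℝ)) :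
    LinearMap.trace ℝ _ (rankOne q V) = q.1 ⬝ᵥ V.1 + q.2 ⬝ᵥ V.2 := by
  let l : ((ι → ℝ) × (ι → ℝ)) →ₗ[ℝ] ℝ :=
    { toFun := fun X => q.1 ⬝ᵥ X.1 + q.2 ⬝ᵥ X.2
      map_add' := fun X Y => by simp only [Prod.fst_add, Prod.snd_add, dotProduct_add]; ring
      map_smul' := fun c X => by simp [mul_add] }
  exact LinearMap.trace_smulRight l V

theorem trace_blockFst :
    LinearMap.trace ℝ _ (blockFst (ι := ι)) = Fintype.card ι := by
  rw [blockFst, LinearMap.trace_comp_comm',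
    show LinearMap.fst ℝ (ι → ℝ) (ι → ℝ) ∘ₗ LinearMap.inl ℝ _ _ = LinearMap.id from rfl]
  simp

theorem trace_blockSnd :
    LinearMap.trace ℝ _ (blockSnd (ι := ι)) = Fintype.card ι := by
  rw [blockSnd, LinearMap.trace_comp_comm',
    show LinearMap.snd ℝ (ι → ℝ) (ι → ℝ) ∘ₗ LinearMap.inr ℝ _ _ = LinearMap.id from rfl]
  simp

theorem trace_offdiag (k l : ℝ) (f : ((ι → ℝ) × (ι → ℝ)) →ₗ[ℝ] ((ι → ℝ) × (ι → ℝ)))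
    (h : ∀ X, f X = (k • X.2, l • X.1)) : LinearMap.trace ℝ _ f = 0 := by
  have h1 : f = k • (LinearMap.inl ℝ (ι → ℝ) (ι → ℝ) ∘ₗ LinearMap.snd ℝ _ _)
      + l • (LinearMap.inr ℝ (ι → ℝ) (ι → ℝ) ∘ₗ LinearMap.fst ℝ _ _) := by
    ext X <;> simp [h]
  have h2 : LinearMap.trace ℝ _ (LinearMap.inl ℝ (ι → ℝ) (ι → ℝ) ∘ₗ LinearMap.snd ℝ _ _) = 0 := by
    rw [LinearMap.trace_comp_comm', LinearMap.snd_comp_inl, map_zero]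
  have h3 : LinearMap.trace ℝ _ (LinearMap.inr ℝ (ι → ℝ) (ι → ℝ) ∘ₗ LinearMap.fst ℝ _ _) = 0 := by
    rw [LinearMap.trace_comp_comm', LinearMap.fst_comp_inr, map_zero]
  rw [h1, map_add, map_smul, map_smul, h2, h3, smul_zero, smul_zero, add_zero]

theorem trace_blockSwap : LinearMap.trace ℝ _ (blockSwap (ι := ι)) = 0 :=
  trace_offdiag 1 1 _ fun X => by simp [blockSwap_apply]

theorem trace_rot : LinearMap.trace ℝ _ (rot (ι := ι)) = 0 :=
  trace_offdiag (-1) 1 _ fun X => by simp [rot_apply]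

/-- The orthogonal projection on the tangent space of the unit conormal bundle. -/
def linkProj (p : (ι → ℝ) × (ι → ℝ)) : ((ι → ℝ) × (ι → ℝ)) →ₗ[ℝ] ((ι → ℝ) × (ι → ℝ)) :=
  LinearMap.id - rankOne (p.1, 0) (p.1, 0) - rankOne (0, p.2) (0, p.2)
    - (2⁻¹ : ℝ) • rankOne (p.2, p.1) (p.2, p.1)

theorem linkProj_mem {p : (ι → ℝ) × (ι → ℝ)} (hp : linkForm ι p p = (1, 1, 0))
    (X : (ι → ℝ) × (ι → ℝ)) : linkProj p X ∈ linkTangent p := by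
  obtain ⟨u, v⟩ := p
  simp only [linkForm_apply, Prod.mk.injEq, dotProduct_comm v u] at hp
  obtain ⟨h1, h2, h3⟩ := hp
  have h3 : u ⬝ᵥ v = 0 := by linarith
  have h4 : v ⬝ᵥ u = 0 := by rw [dotProduct_comm, h3]
  rw [mem_linkTangent_iff]
  simp [linkProj, rankOne_apply, h1, h2, h3, h4, dotProduct_sub]
  ring

theorem linkProj_eq_self {p X : (ι → ℝ) × (ι → ℝ)} (hX : X ∈ linkTangent p) :
    linkProj p X = X := by
  obtain ⟨h1, h2, h3⟩ := mem_linkTangent_iff.1 hX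
  simp [linkProj, rankOne_apply, h1, h2, h3]

/-- The tangential trace is the full trace minus the contributions of the normals (û, 0), (0, v̂),
(v̂, û); the last has squared length 2 on the bundle, whence the factor 1/2. -/
theorem trace_comp_linkProj (p : (ι → ℝ) × (ι → ℝ))
    (R : ((ι → ℝ) × (ι → ℝ)) →ₗ[ℝ] ((ι → ℝ) × (ι → ℝ))) :
    LinearMap.trace ℝ _ (R ∘ₗ linkProj p) = LinearMap.trace ℝ _ R - p.1 ⬝ᵥ (R (p.1, 0)).1
      - p.2 ⬝ᵥ (R (0, p.2)).2
      - 2⁻¹ * (p.2 ⬝ᵥ (R (p.2, p.1)).1 + p.1 ⬝ᵥ (R (p.2, p.1)).2) := by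
  have h1 : R ∘ₗ linkProj p = R - rankOne (p.1, 0) (R (p.1, 0)) - rankOne (0, p.2) (R (0, p.2))
      - (2⁻¹ : ℝ) • rankOne (p.2, p.1) (R (p.2, p.1)) := by
    refine LinearMap.ext fun X => ?_
    simp only [linkProj, LinearMap.comp_apply, LinearMap.sub_apply, LinearMap.id_apply,
      LinearMap.smul_apply, rankOne_apply, map_sub, map_smul, zero_dotProduct, add_zero, zero_add]
  rw [h1]
  simp [trace_rankOne]

/-- The curvature is sorted as a linear map of its first argument `A` into blocks and rank one maps,
so that its trace can be read off. The four groups are `D_A Q(B, C)`, `D_B Q(A, C)`, `Q(A, Q(B, C))`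
and `Q(B, Q(A, C))`, with signs `+ - + -`. -/
theorem curvature_linkConnection (κ : ℝ) (p B C : (ι → ℝ) × (ι → ℝ)) :
    curvature (linkConnection κ) p B C =
      ((B.1 ⬝ᵥ C.1) • blockFst + (B.2 ⬝ᵥ C.2) • blockSnd
        + (2⁻¹ * (B.1 ⬝ᵥ C.2 + B.2 ⬝ᵥ C.1)) • blockSwap
        - κ • (rankOne (C.2, 0) (rot B) + rankOne (B.2, 0) (rot C)
          + (2 * (p.1 ⬝ᵥ C.2)) • rankOne (B.2, 0) p + (2 * (p.1 ⬝ᵥ B.2)) • rankOne (C.2, 0) p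
          + (2 * (p.1 ⬝ᵥ B.2) * (p.1 ⬝ᵥ C.2)) • LinearMap.id))
      - (rankOne (C.1, 0) (B.1, 0) + rankOne (0, C.2) (0, B.2)
        + (2⁻¹ : ℝ) • rankOne (C.2, C.1) (B.2, B.1)
        - κ • ((B.1 ⬝ᵥ C.2) • rot + rankOne (0, B.1) (rot C)
          + (2 * (B.1 ⬝ᵥ C.2)) • rankOne (0, p.1) p + (2 * (p.1 ⬝ᵥ C.2)) • rankOne (0, B.1) p
          + (2 * (p.1 ⬝ᵥ C.2)) • rankOne (0, p.1) B))
      + (rankOne ((linkConnection κ p B C).1, 0) (p.1, 0) + rankOne (0, (linkConnection κ p B C).2) (0, p.2) + (2⁻¹ : ℝ) • rankOne ((linkConnection κ p B C).2, (linkConnection κ p B C).1) (p.2, p.1)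
        - κ • ((p.1 ⬝ᵥ (linkConnection κ p B C).2) • rot + rankOne (0, p.1) (rot (linkConnection κ p B C)) + (2 * (p.1 ⬝ᵥ (linkConnection κ p B C).2)) • rankOne (0, p.1) p))
      - (rankOne (C.1, 0) (linkConnection κ p B (p.1, 0)) + rankOne (0, C.2) (linkConnection κ p B (0, p.2))
        + (2⁻¹ : ℝ) • rankOne (C.2, C.1) (linkConnection κ p B (p.2, p.1))
        - κ • ((p.1 ⬝ᵥ C.2) • (rankOne (0, -B.1) (p.1, 0) + rankOne (B.2, 0) (0, p.2)
            + (2⁻¹ : ℝ) • rankOne (B.1, -B.2) (p.2, p.1)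
            - κ • (-(p.1 ⬝ᵥ B.2) • LinearMap.id + rankOne (p.1, 0) (rot B)
              + (2 * (p.1 ⬝ᵥ B.2)) • rankOne (p.1, 0) p))
          + rankOne (0, p.1) (linkConnection κ p B (rot C)) + (2 * (p.1 ⬝ᵥ C.2)) • rankOne (0, p.1) (linkConnection κ p B p))) := by
  let Q := linkConnection κ p
  let D := Q B C
  let N₁ : (ι → ℝ) × (ι → ℝ) := (p.1, 0)
  let N₂ : (ι → ℝ) × (ι → ℝ) := (0, p.2)
  let N₃ : (ι → ℝ) × (ι → ℝ) := (p.2, p.1)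
  let η₀ : (ι → ℝ) × (ι → ℝ) := (0, p.1)
  refine LinearMap.ext fun A => ?_
  have e1 := fderiv_linkConnection κ p A B C
  have e2 := fderiv_linkConnection κ p B A C
  have e3 : Q A D = (rankOne (D.1, 0) N₁ + rankOne (0, D.2) N₂
      + (2⁻¹ : ℝ) • rankOne (D.2, D.1) N₃
      - κ • ((p.1 ⬝ᵥ D.2) • rot + rankOne η₀ (rot D) + (2 * (p.1 ⬝ᵥ D.2)) • rankOne η₀ p) :
        ((ι → ℝ) × (ι → ℝ)) →ₗ[ℝ] ((ι → ℝ) × (ι → ℝ))) A := by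
    simp only [Q, linkConnection_apply, dotProduct_comm A.1, dotProduct_comm A.2]
    ext <;> simp [rankOne_apply, N₁, N₂, N₃, η₀] <;> ring
  have e4 : Q B (rot A) = (rankOne (0, -B.1) N₁ + rankOne (B.2, 0) N₂
          + (2⁻¹ : ℝ) • rankOne (B.1, -B.2) N₃
          - κ • (-(p.1 ⬝ᵥ B.2) • LinearMap.id + rankOne (p.1, 0) (rot B)
            + (2 * (p.1 ⬝ᵥ B.2)) • rankOne (p.1, 0) p) :
        ((ι → ℝ) × (ι → ℝ)) →ₗ[ℝ] ((ι → ℝ) × (ι → ℝ))) A := by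
    simp only [Q, linkConnection_apply]
    ext <;> simp [rankOne_apply, rot_apply, N₁, N₂, N₃] <;> ring
  have e5 : Q B (Q A C) = (C.1 ⬝ᵥ A.1) • Q B N₁ + (C.2 ⬝ᵥ A.2) • Q B N₂
      + (2⁻¹ * (C.2 ⬝ᵥ A.1 + C.1 ⬝ᵥ A.2)) • Q B N₃
      - κ • ((p.1 ⬝ᵥ C.2) • Q B (rot A) + (p.1 ⬝ᵥ A.2) • Q B (rot C)
        + (2 * (p.1 ⬝ᵥ A.2) * (p.1 ⬝ᵥ C.2)) • Q B p) := by
    rw [show Q A C = _ from linkConnection_apply κ p A C]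
    simp only [map_add, map_sub, map_smul, dotProduct_comm A.1, dotProduct_comm A.2]
    rfl
  change fderiv ℝ (linkConnection κ) p A B C - fderiv ℝ (linkConnection κ) p B A C
    + Q A D - Q B (Q A C) = _
  rw [e1, e2, e3, e5, e4]
  simp only [dotProduct_comm A.1, dotProduct_comm A.2]
  generalize Q B N₁ = V₁, Q B N₂ = V₂, Q B N₃ = V₃, Q B (rot C) = V₄, Q B p = V₅
  ext <;> simp [rankOne_apply, rot_apply, blockFst_apply, blockSnd_apply, blockSwap_apply,
    N₁, N₂, N₃, η₀] <;> ring

/-- With card ι = n + 1 the hypothesis says κ = 1/n: this is the squashing along the Reeb direction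
that makes the metric Einstein. -/
theorem trace_curvature_linkConnection {κ : ℝ} (hκ : κ * (Fintype.card ι - 1) = 1)
    {p B C : (ι → ℝ) × (ι → ℝ)} (hp : linkForm ι p p = (1, 1, 0)) (hB : B ∈ linkTangent p)
    (hC : C ∈ linkTangent p) :
    LinearMap.trace ℝ _ (curvature (linkConnection κ) p B C ∘ₗ linkProj p) =
      (Fintype.card ι - 2) * (1 - κ)
        * (B.1 ⬝ᵥ C.1 + B.2 ⬝ᵥ C.2 - 2 * κ * ((p.1 ⬝ᵥ B.2) * (p.1 ⬝ᵥ C.2))) := by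
  rw [mem_linkTangent_iff] at hB hC
  obtain ⟨u, v⟩ := p
  obtain ⟨b₁, b₂⟩ := B
  obtain ⟨c₁, c₂⟩ := C
  simp only [linkForm_apply, Prod.mk.injEq, dotProduct_comm v u] at hp hB hC
  obtain ⟨huu, hvv, huv⟩ := hp
  obtain ⟨hB1, hB2, hB3⟩ := hB
  obtain ⟨hC1, hC2, hC3⟩ := hC
  replace huv : u ⬝ᵥ v = 0 := by linarith
  have hvu : v ⬝ᵥ u = 0 := by rw [dotProduct_comm, huv]
  rw [trace_comp_linkProj, curvature_linkConnection]
  simp only [map_add, map_sub, map_smul, trace_rankOne, trace_blockFst, trace_blockSnd,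
    trace_blockSwap, trace_rot, LinearMap.trace_id, LinearMap.add_apply, LinearMap.sub_apply,
    LinearMap.smul_apply, rankOne_apply, blockFst_apply, blockSnd_apply, blockSwap_apply,
    rot_apply, LinearMap.id_apply, Prod.fst_add, Prod.snd_add, Prod.fst_sub, Prod.snd_sub,
    Prod.smul_fst, Prod.smul_snd, dotProduct_add, dotProduct_sub, dotProduct_smul,
    linkConnection_apply, smul_eq_mul, dotProduct_neg, neg_dotProduct, dotProduct_zero,
    zero_dotProduct, dotProduct_comm b₁ u, dotProduct_comm b₂ u, dotProduct_comm b₁ v,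
    dotProduct_comm b₂ v, dotProduct_comm c₁ u, dotProduct_comm c₂ u, dotProduct_comm c₁ v,
    dotProduct_comm c₂ v, dotProduct_comm c₁ b₁, dotProduct_comm c₁ b₂, dotProduct_comm c₂ b₁,
    dotProduct_comm c₂ b₂, huu, hvv, huv, hvu, hB1, hB2, hB3, hC1, hC2, hC3,
    Module.finrank_prod, Module.finrank_fintype_fun_eq_card]
  push_cast
  -- For general κ the Ricci form differs from the right-hand side by κ(card ι - 1) - 1 times the
  -- Euclidean metric minus 2η². This form kills the Reeb vector (-v̂, û), so it is the horizontal
  -- part of the Euclidean metric.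
  linear_combination (b₁ ⬝ᵥ c₁ + b₂ ⬝ᵥ c₂ - 2 * ((u ⬝ᵥ b₂) * (u ⬝ᵥ c₂))) * hκ

end LinkRicci

theorem fderiv_quadratic {𝕜 E G : Type*} [RCLike 𝕜] [NormedAddCommGroup E] [NormedSpace 𝕜 E]
    [NormedAddCommGroup G] [NormedSpace 𝕜 G] {β : E →L[𝕜] E →L[𝕜] G} (hβ : ∀ A B, β A B = β B A)
    (q X : E) : fderiv 𝕜 (fun q => β q q) q X = (2 : 𝕜) • β q X := by
  have h : fderiv 𝕜 (fun q => β q q) q = _ := (β.hasFDerivAt.clm_apply (hasFDerivAt_id q)).fderiv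
  rw [h, two_smul]
  simp only [add_apply, ContinuousLinearMap.comp_apply, ContinuousLinearMap.flip_apply, id]
  rw [hβ X q]
  rfl

/-! ### The link metric is Riemannian and Einstein -/

section LinkMetric

theorem mem_unitConormal_iff {n : ℕ} {p : (Fin (n + 1) → ℝ) × (Fin (n + 1) → ℝ)} :
    p ∈ unitConormal n ↔ linkForm (Fin (n + 1)) p p = (1, 1, 0) := by
  simp only [unitConormal, Set.mem_ofPred_eq, linkForm_apply, Prod.mk.injEq, dotProduct, ← sq,
    mul_comm (p.2 _)]
  constructor <;> rintro ⟨h1, h2, h3⟩ <;> exact ⟨h1, h2, by linarith⟩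

theorem linkMetric_apply (n : ℕ) (p A B : (Fin (n + 1) → ℝ) × (Fin (n + 1) → ℝ)) :
    linkMetric n p A B = (((n : ℝ) - 1) / (2 * n)) * (A.1 ⬝ᵥ B.1 + A.2 ⬝ᵥ B.2
      - 2 * (n : ℝ)⁻¹ * ((p.1 ⬝ᵥ A.2) * (p.1 ⬝ᵥ B.2))) := by
  simp only [linkMetric, hPrime, LinearMap.smul_apply, LinearMap.mk₂_apply, smul_eq_mul,
    dotProduct, Finset.sum_add_distrib, div_eq_mul_inv]

theorem contDiff_linkMetric (n : ℕ) (A B : (Fin (n + 1) → ℝ) × (Fin (n + 1) → ℝ)) :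
    ContDiff ℝ ∞ (fun p => linkMetric n p A B) := by
  simp only [linkMetric_apply, dotProduct]
  fun_prop

theorem fderiv_linkMetric (n : ℕ) (p A B C : (Fin (n + 1) → ℝ) × (Fin (n + 1) → ℝ)) :
    fderiv ℝ (fun q => linkMetric n q B C) p A = (((n : ℝ) - 1) / (2 * n)) *
      -(2 * (n : ℝ)⁻¹ * ((A.1 ⬝ᵥ B.2) * (p.1 ⬝ᵥ C.2) + (p.1 ⬝ᵥ B.2) * (A.1 ⬝ᵥ C.2))) := by
  refine fderiv_eq_of_line ((contDiff_linkMetric n B C).differentiable (by simp) p)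
    (hasDerivAt_of_eq_cubic (v₀ := linkMetric n p B C)
      (v₂ := (((n : ℝ) - 1) / (2 * n)) * -(2 * (n : ℝ)⁻¹ * ((A.1 ⬝ᵥ B.2) * (A.1 ⬝ᵥ C.2))))
      (v₃ := 0) fun s => ?_)
  simp only [linkMetric_apply, Prod.fst_add, Prod.smul_fst, add_dotProduct, smul_dotProduct,
    smul_eq_mul]
  ring

/-- With η = û · dv̂ one has dη(X, Y) = ⟨rot X, Y⟩, and the tangential part of rot X is rot X + η(X)
p. Koszul's formula for the Euclidean metric minus 2κη² adds -κ(η(Y)(rot X + η(X) p) + η(X)(rot Y +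
η(Y) p)) to the Euclidean connection of the bundle. The overall factor of the metric does not affect
the connection. -/
theorem isLeviCivita_link (n : ℕ) :
    IsLeviCivita (unitConormal n) linkTangent Set.univ (linkMetric n)
      (linkConnection (n : ℝ)⁻¹) where
  isOpen := isOpen_univ
  subset := Set.subset_univ _
  smooth_metric B C := (contDiff_linkMetric n B C).contDiffOn
  symm_metric p _ B C := by
    rw [linkMetric_apply, linkMetric_apply, dotProduct_comm C.1, dotProduct_comm C.2]
    ring
  smooth := (contDiff_linkConnection _).contDiffOn
  symm := linkConnection_symm _
  compat := by
    rintro ⟨u, v⟩ hp ⟨a₁, a₂⟩ hA ⟨b₁, b₂⟩ hB ⟨c₁, c₂⟩ hC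
    rw [mem_unitConormal_iff] at hp
    rw [mem_linkTangent_iff] at hA hB hC
    simp only [linkForm_apply, Prod.mk.injEq, dotProduct_comm v u] at hp hA hB hC
    obtain ⟨huu, hvv, huv⟩ := hp
    obtain ⟨hA1, hA2, hA3⟩ := hA
    obtain ⟨hB1, hB2, hB3⟩ := hB
    obtain ⟨hC1, hC2, hC3⟩ := hC
    replace huv : u ⬝ᵥ v = 0 := by linarith
    have hvu : v ⬝ᵥ u = 0 := by rw [dotProduct_comm, huv]
    rw [fderiv_linkMetric, linkMetric_apply, linkMetric_apply, ← mul_add]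
    congr 1
    simp only [linkConnection_apply, rot_apply, Prod.fst_add, Prod.snd_add, Prod.fst_sub,
      Prod.snd_sub, Prod.smul_fst, Prod.smul_snd, dotProduct_add, dotProduct_sub, dotProduct_smul,
      add_dotProduct, sub_dotProduct, smul_dotProduct, smul_eq_mul, dotProduct_neg,
      neg_dotProduct, dotProduct_zero, zero_dotProduct,
      dotProduct_comm b₁ u, dotProduct_comm b₂ u,
      dotProduct_comm b₁ v, dotProduct_comm b₂ v, dotProduct_comm b₁ a₂, dotProduct_comm b₂ a₁,
      huu, huv, hA1, hB1, hB2, hB3, hC1, hC2, hC3]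
    ring

/-- The κ-terms of `linkConnection` are tangent, so only the Euclidean second fundamental form
contributes. -/
theorem linkForm_linkConnection {n : ℕ} {p : (Fin (n + 1) → ℝ) × (Fin (n + 1) → ℝ)}
    (hp : p ∈ unitConormal n) {A B : (Fin (n + 1) → ℝ) × (Fin (n + 1) → ℝ)}
    (hA : A ∈ linkTangent p) (hB : B ∈ linkTangent p) (κ : ℝ) :
    linkForm _ p (linkConnection κ p A B) = linkForm _ A B := by
  obtain ⟨u, v⟩ := p
  obtain ⟨a₁, a₂⟩ := A
  obtain ⟨b₁, b₂⟩ := B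
  rw [mem_unitConormal_iff] at hp
  rw [mem_linkTangent_iff] at hA hB
  simp only [linkForm_apply, Prod.mk.injEq, dotProduct_comm v u] at hp hA hB
  obtain ⟨huu, hvv, huv⟩ := hp
  obtain ⟨hA1, hA2, hA3⟩ := hA
  obtain ⟨hB1, hB2, hB3⟩ := hB
  replace huv : u ⬝ᵥ v = 0 := by linarith
  have hvu : v ⬝ᵥ u = 0 := by rw [dotProduct_comm, huv]
  simp only [linkForm_apply, linkConnection_apply, rot_apply, Prod.fst_add, Prod.snd_add,
    Prod.fst_sub, Prod.snd_sub, Prod.smul_fst, Prod.smul_snd, dotProduct_add, dotProduct_sub,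
    dotProduct_smul, smul_eq_mul, dotProduct_neg, dotProduct_zero, huu, hvv, huv, hvu, hA1, hA2,
    hA3, hB1, hB2, hB3, Prod.mk.injEq]
  refine ⟨?_, ?_, ?_⟩ <;> ring

/-- For tangent X the number û · X₂ equals -(v̂ · X₁), so Cauchy–Schwarz bounds its square by both
|X₁|² and |X₂|². Hence (2/n) η(X)² ≤ η(X)² ≤ |X|²/2. -/
theorem linkMetric_pos {n : ℕ} (hn : 2 ≤ n) {p : (Fin (n + 1) → ℝ) × (Fin (n + 1) → ℝ)}
    (hp : p ∈ unitConormal n) {X : (Fin (n + 1) → ℝ) × (Fin (n + 1) → ℝ)}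
    (hX : X ∈ linkTangent p) (h0 : X ≠ 0) : 0 < linkMetric n p X X := by
  have hn' : (2 : ℝ) ≤ n := by exact_mod_cast hn
  rw [mem_linkTangent_iff] at hX
  have hp1 : ∑ j, p.1 j ^ 2 = 1 := hp.1
  have hp2 : ∑ j, p.2 j ^ 2 = 1 := hp.2.1
  have c1 := Finset.sum_mul_sq_le_sq_mul_sq Finset.univ p.1 X.2
  have c2 := Finset.sum_mul_sq_le_sq_mul_sq Finset.univ p.2 X.1
  have e1 : ∑ j, X.1 j ^ 2 = X.1 ⬝ᵥ X.1 := by simp only [dotProduct, sq]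
  have e2 : ∑ j, X.2 j ^ 2 = X.2 ⬝ᵥ X.2 := by simp only [dotProduct, sq]
  change (p.1 ⬝ᵥ X.2) ^ 2 ≤ _ at c1
  change (p.2 ⬝ᵥ X.1) ^ 2 ≤ _ at c2
  rw [hp1, one_mul, e2] at c1
  rw [hp2, one_mul, hX.2.2, neg_sq, e1] at c2
  have hpos : 0 < X.1 ⬝ᵥ X.1 + X.2 ⬝ᵥ X.2 := by
    have h1 : 0 ≤ X.1 ⬝ᵥ X.1 := by rw [← e1]; positivity
    have h2 : 0 ≤ X.2 ⬝ᵥ X.2 := by rw [← e2]; positivity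
    refine lt_of_le_of_ne (add_nonneg h1 h2) fun h => h0 ?_
    have h3 : X.1 ⬝ᵥ X.1 = 0 := by linarith
    have h4 : X.2 ⬝ᵥ X.2 = 0 := by linarith
    exact Prod.ext (dotProduct_self_eq_zero.1 h3) (dotProduct_self_eq_zero.1 h4)
  rw [linkMetric_apply]
  have hinv : (n : ℝ)⁻¹ ≤ 2⁻¹ := inv_anti₀ (by norm_num) hn'
  have hinv0 : 0 ≤ (n : ℝ)⁻¹ := by positivity
  refine mul_pos (div_pos (by linarith) (by linarith)) ?_
  have : 2 * (n : ℝ)⁻¹ * ((p.1 ⬝ᵥ X.2) * (p.1 ⬝ᵥ X.2)) ≤ (p.1 ⬝ᵥ X.2) ^ 2 := by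
    nlinarith [sq_nonneg (p.1 ⬝ᵥ X.2)]
  linarith

theorem exists_isLinearParam_link {n : ℕ} (hn : 2 ≤ n)
    {p : (Fin (n + 1) → ℝ) × (Fin (n + 1) → ℝ)} (hp : p ∈ unitConormal n) :
    ∃ (U : Set (Fin (2 * n - 1) → ℝ))
      (φ : (Fin (2 * n - 1) → ℝ) → (Fin (n + 1) → ℝ) × (Fin (n + 1) → ℝ))
      (L : ((Fin (n + 1) → ℝ) × (Fin (n + 1) → ℝ)) →L[ℝ] (Fin (2 * n - 1) → ℝ)),
      IsLinearParam (unitConormal n) linkTangent U φ L ∧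
      Tangential linkTangent U φ (linkConnection (n : ℝ)⁻¹) ∧ p ∈ φ '' U := by
  let β := linkForm (Fin (n + 1))
  have hβp : β p p = (1, 1, 0) := mem_unitConormal_iff.1 hp
  have hc : ContDiff ℝ ∞ (fun q => β q q) := β.contDiff.clm_apply contDiff_id
  have hd : ∀ q X, fderiv ℝ (fun q => β q q) q X = (2 : ℝ) • β q X :=
    fderiv_quadratic linkForm_symm
  have hsurj : Function.Surjective (fderiv ℝ (fun q => β q q) p) := by
    rintro ⟨a, b, c⟩
    have huu : p.1 ⬝ᵥ p.1 = 1 := congrArg Prod.fst hβp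
    have hvv : p.2 ⬝ᵥ p.2 = 1 := congrArg (fun q => q.2.1) hβp
    have huv : p.1 ⬝ᵥ p.2 + p.2 ⬝ᵥ p.1 = 0 := congrArg (fun q => q.2.2) hβp
    have hvu : p.2 ⬝ᵥ p.1 = 0 := by rw [dotProduct_comm p.1] at huv; linarith
    have huv' : p.1 ⬝ᵥ p.2 = 0 := by rw [dotProduct_comm, hvu]
    -- The halves compensate the factor 2 in the derivative of the quadratic map; orthonormality of
    -- û and v̂ separates the three constraints.
    refine ⟨((a / 2) • p.1, (b / 2) • p.2 + (c / 2) • p.1), ?_⟩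
    rw [hd]
    simp only [β, linkForm_apply, dotProduct_add, dotProduct_smul, huu, hvv, hvu, huv',
      smul_eq_mul, Prod.smul_mk, Prod.mk.injEq]
    refine ⟨?_, ?_, ?_⟩ <;> ring
  obtain ⟨U, φ, L, W, hU, hW, -, hpU, hφ, him, hL, hker⟩ :=
    exists_param_levelSet (F := Fin (2 * n - 1) → ℝ) (fun q => β q q) hc p hsurj
      -- Dimension count: (2n - 1) + 3 = 2(n + 1).
      (by simp; omega) isOpen_univ (Set.mem_univ p)
  have hset : {q | β q q = β p p} = unitConormal n := by
    ext q
    rw [Set.mem_ofPred_eq, hβp, mem_unitConormal_iff]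
  rw [hset] at him
  have hlin : IsLinearParam (unitConormal n) linkTangent U φ L :=
    isLinearParam_of_quadric (β := β) (k := (1, 1, 0)) linkForm_symm
      (fun q hq => mem_unitConormal_iff.1 hq) (fun _ _ => mem_linkTangent) hU hφ hW him hL
      fun x hx X hX => hker x hx X (by rw [hd, hX, smul_zero])
  exact ⟨U, φ, L, hlin, tangential_of_quadric (β := β) hlin (fun _ _ => mem_linkTangent)
    fun q hq A hA B hB => linkForm_linkConnection hq hA hB _, hpU⟩

theorem isRiemannianMetric_link {n : ℕ} (hn : 2 ≤ n) :
    IsRiemannianMetric (Fin (2 * n - 1) → ℝ) (unitConormal n) (linkMetric n) := by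
  refine isRiemannianMetric_of_isLinearParam (isLeviCivita_link n)
    (fun p hp X hX h0 => linkMetric_pos hn hp hX h0) fun p hp => ?_
  obtain ⟨U, φ, L, h1, -, h2⟩ := exists_isLinearParam_link hn hp
  exact ⟨U, φ, L, h1, h2⟩

/-- Ricci is (n - 1)(1 - 1/n) h', and dividing by the factor (n - 1)/(2n) gives 2n - 2, one less
than the dimension of the link. -/
theorem isEinstein_link {n : ℕ} (hn : 2 ≤ n) :
    IsEinstein (Fin (2 * n - 1) → ℝ) (unitConormal n) (linkMetric n) (2 * n - 2) := by
  have hn' : (2 : ℝ) ≤ n := by exact_mod_cast hn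
  refine isEinstein_of_isLinearParam (isLeviCivita_link n) linkProj
    (fun p hp => linkProj_mem (mem_unitConormal_iff.1 hp)) (fun p _ X hX => linkProj_eq_self hX)
    (fun p hp => exists_isLinearParam_link hn hp) fun p hp B hB C hC => ?_
  rw [trace_curvature_linkConnection _ (mem_unitConormal_iff.1 hp) hB hC, linkMetric_apply]
  · simp only [Fintype.card_fin]
    push_cast
    field_simp
    ring
  · simp only [Fintype.card_fin]
    push_cast
    field_simp
    ring

end LinkMetric

/-! ### The metric of the potential C t^α in closed form -/

section Potential

variable {n : ℕ}

theorem normSq_eq (w : Fin (n + 1) → ℂ) : (normSq w : ℂ) = w ⬝ᵥ star w := by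
  simp [normSq, dotProduct, Complex.mul_conj]

theorem normSq_nonneg (w : Fin (n + 1) → ℂ) : 0 ≤ normSq w :=
  Finset.sum_nonneg fun _ _ => Complex.normSq_nonneg _

theorem normSq_pos {w : Fin (n + 1) → ℂ} (hw : w ≠ 0) : 0 < normSq w := by
  refine lt_of_le_of_ne (normSq_nonneg w) fun h => hw ?_
  have h1 := (Finset.sum_eq_zero_iff_of_nonneg fun j _ => Complex.normSq_nonneg (w j)).1 h.symm
  exact funext fun j => Complex.normSq_eq_zero.1 (h1 j (Finset.mem_univ j))

theorem contDiff_normSq : ContDiff ℝ ∞ (normSq (n := n)) := by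
  have h : ∀ j, ContDiff ℝ ∞ fun w : Fin (n + 1) → ℂ => Complex.normSq (w j) := by
    intro j
    simp only [Complex.normSq_apply]
    have h1 : ContDiff ℝ ∞ fun w : Fin (n + 1) → ℂ => w j := contDiff_apply ℝ ℂ j
    have h2 := Complex.reCLM.contDiff.comp h1 (n := ∞)
    have h3 := Complex.imCLM.contDiff.comp h1 (n := ∞)
    exact (h2.mul h2).add (h3.mul h3)
  exact ContDiff.sum fun j _ => h j

theorem hasDerivAt_normSq (w A : Fin (n + 1) → ℂ) :
    HasDerivAt (fun s : ℝ => normSq (w + s • A)) (2 * (A ⬝ᵥ star w).re) 0 := by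
  refine hasDerivAt_of_eq_cubic (v₀ := normSq w) (v₂ := normSq A) (v₃ := 0) fun s => ?_
  simp only [normSq, dotProduct, Complex.re_sum, Finset.mul_sum, smul_eq_mul, mul_zero, add_zero,
    ← Finset.sum_add_distrib]
  refine Finset.sum_congr rfl fun j _ => ?_
  simp [Complex.normSq_apply]
  ring

theorem hasDerivAt_normSq_rpow {w : Fin (n + 1) → ℂ} (hw : w ≠ 0) (A : Fin (n + 1) → ℂ) (β : ℝ) :
    HasDerivAt (fun s : ℝ => normSq (w + s • A) ^ β)
      (2 * (A ⬝ᵥ star w).re * β * normSq w ^ (β - 1)) 0 := by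
  have h := (hasDerivAt_normSq w A).rpow_const (p := β)
    (Or.inl (by simpa using (normSq_pos hw).ne'))
  simpa using h

theorem contDiffOn_normSq_rpow (β : ℝ) :
    ContDiffOn ℝ ∞ (fun w : Fin (n + 1) → ℂ => normSq w ^ β) {0}ᶜ :=
  contDiff_normSq.contDiffOn.rpow_const_of_ne fun _ hw => (normSq_pos hw).ne'

theorem differentiableAt_normSq_rpow {w : Fin (n + 1) → ℂ} (hw : w ≠ 0) (β : ℝ) :
    DifferentiableAt ℝ (fun w : Fin (n + 1) → ℂ => normSq w ^ β) w :=
  ((contDiffOn_normSq_rpow β).contDiffAt (isOpen_compl_singleton.mem_nhds hw)).differentiableAt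
    (by simp)

theorem dwbar_potential {w : Fin (n + 1) → ℂ} (hw : w ≠ 0) (C α : ℝ) (k : Fin (n + 1)) :
    dwbar k (fun z => ((C * normSq z ^ α : ℝ) : ℂ)) w
      = ((C * α * normSq w ^ (α - 1) : ℝ) : ℂ) * w k := by
  have h : ∀ A, fderiv ℝ (fun z : Fin (n + 1) → ℂ => ((C * normSq z ^ α : ℝ) : ℂ)) w A
      = ((C * (2 * (A ⬝ᵥ star w).re * α * normSq w ^ (α - 1)) : ℝ) : ℂ) := fun A =>
    fderiv_eq_of_line (Complex.ofRealCLM.differentiableAt.comp w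
      ((differentiableAt_normSq_rpow hw α).const_mul C))
      ((hasDerivAt_normSq_rpow hw A α).const_mul C).ofReal_comp
  rw [dwbar, h, h]
  simp only [single_dotProduct, Pi.star_apply, RCLike.star_def, one_mul]
  apply Complex.ext <;> simp <;> ring

theorem dw_dwbar_potential {w : Fin (n + 1) → ℂ} (hw : w ≠ 0) (C α : ℝ) (j k : Fin (n + 1)) :
    dw j (dwbar k (fun z => ((C * normSq z ^ α : ℝ) : ℂ))) w
      = ((C * α * normSq w ^ (α - 1) : ℝ) : ℂ) * ((if j = k then 1 else 0)
        + (((α - 1) * (normSq w)⁻¹ : ℝ) : ℂ) * (conj (w j) * w k)) := by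
  have heq : dwbar k (fun z => ((C * normSq z ^ α : ℝ) : ℂ)) =ᶠ[𝓝 w]
      fun z : Fin (n + 1) → ℂ => ((C * α * normSq z ^ (α - 1) : ℝ) : ℂ) * z k :=
    Filter.eventuallyEq_of_mem (isOpen_compl_singleton.mem_nhds hw) fun z hz =>
      dwbar_potential hz C α k
  have hk : ∀ A, HasDerivAt (fun s : ℝ => (w + s • A) k) (A k) 0 := fun A =>
    hasDerivAt_of_eq_cubic (v₀ := w k) (v₂ := 0) (v₃ := 0) fun s => by simp
  have h : ∀ A, fderiv ℝ (dwbar k (fun z => ((C * normSq z ^ α : ℝ) : ℂ))) w A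
      = ((C * α * (2 * (A ⬝ᵥ star w).re * (α - 1) * normSq w ^ (α - 1 - 1)) : ℝ) : ℂ) * w k
        + ((C * α * normSq w ^ (α - 1) : ℝ) : ℂ) * A k := by
    intro A
    rw [heq.fderiv_eq]
    refine fderiv_eq_of_line ((Complex.ofRealCLM.differentiableAt.comp w
      ((differentiableAt_normSq_rpow hw (α - 1)).const_mul (C * α))).mul
      (differentiableAt_apply k w)) ?_
    have h1 := ((hasDerivAt_normSq_rpow hw A (α - 1)).const_mul (C * α)).ofReal_comp.mul (hk A)
    refine h1.congr_deriv ?_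
    simp
  rw [dw, h, h, Real.rpow_sub_one (normSq_pos hw).ne' (α - 1)]
  simp only [single_dotProduct, Pi.star_apply, RCLike.star_def, one_mul, Pi.single_apply,
    eq_comm (a := k)]
  split_ifs with hjk <;> apply Complex.ext <;> simp <;> ring

/-- The Hermitian form `⟨a, b⟩ + κ |w|⁻² ⟨a, w⟩ ⟨w, b⟩`. -/
def hermForm (κ : ℝ) (w a b : Fin (n + 1) → ℂ) : ℂ :=
  a ⬝ᵥ star b + ((κ * (normSq w)⁻¹ : ℝ) : ℂ) * ((a ⬝ᵥ star w) * (w ⬝ᵥ star b))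

/-- After this point the Wirtinger derivatives are gone: the metric is a power of t times the real
part of an explicit Hermitian form with parameter κ = α - 1. -/
theorem potentialMetric_apply {w : Fin (n + 1) → ℂ} (hw : w ≠ 0) (C α : ℝ)
    (a b : Fin (n + 1) → ℂ) :
    potentialMetric (fun w => C * normSq w ^ α) w a b
      = 2 * (C * α * normSq w ^ (α - 1)) * (hermForm (α - 1) w a b).re := by
  have key : ∑ j, ∑ k, dw j (dwbar k (fun z => ((C * normSq z ^ α : ℝ) : ℂ))) w * a j * conj (b k)
      = ((C * α * normSq w ^ (α - 1) : ℝ) : ℂ) * hermForm (α - 1) w a b := by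
    simp only [hermForm, dotProduct, Finset.sum_mul_sum, Pi.star_apply, RCLike.star_def,
      dw_dwbar_potential hw, mul_add, add_mul, Finset.sum_add_distrib]
    congr 1
    · simp [Finset.mul_sum, mul_assoc]
    · rw [Finset.mul_sum, Finset.mul_sum]
      refine Finset.sum_congr rfl fun j _ => ?_
      rw [Finset.mul_sum, Finset.mul_sum]
      refine Finset.sum_congr rfl fun k _ => ?_
      ring
  change 2 * (∑ j, ∑ k, dw j (dwbar k (fun z => ((C * normSq z ^ α : ℝ) : ℂ))) w * a j
    * conj (b k)).re = _
  rw [key, Complex.re_ofReal_mul]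
  ring

end Potential

/-! ### Real traces of complex linear and antilinear maps -/

section ComplexTrace

variable {ι : Type*} [Fintype ι]

/-- In the real basis `e_j, i e_j` each complex diagonal entry z becomes a 2 × 2 block of trace 2 Re
z. -/
theorem trace_restrictScalars [DecidableEq ι] (f : (ι → ℂ) →ₗ[ℂ] (ι → ℂ)) :
    LinearMap.trace ℝ _ (f.restrictScalars ℝ) = 2 * (LinearMap.trace ℂ _ f).re := by
  rw [LinearMap.trace_eq_matrix_trace ℝ (Complex.basisOneI.smulTower (Pi.basisFun ℂ ι)),
    LinearMap.trace_eq_matrix_trace ℂ (Pi.basisFun ℂ ι), Matrix.trace, Matrix.trace,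
    Fintype.sum_prod_type, Complex.re_sum, Finset.mul_sum, Fin.sum_univ_two,
    ← Finset.sum_add_distrib]
  refine Finset.sum_congr rfl fun i _ => ?_
  have h' : f (Complex.I • Pi.single i 1) = Complex.I • f (Pi.single i 1) := map_smul f _ _
  simp [Matrix.diag, LinearMap.toMatrix_apply, Module.Basis.smulTower_repr,
    Module.Basis.smulTower_apply, h']
  ring

/-- Antilinearity gives f = J f J, and cyclicity of the trace with J² = -1 gives tr f = -tr f. -/
theorem trace_eq_zero_of_antilinear (f : (ι → ℂ) →ₗ[ℝ] (ι → ℂ))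
    (hf : ∀ X, f (Complex.I • X) = -(Complex.I • f X)) : LinearMap.trace ℝ _ f = 0 := by
  let J : (ι → ℂ) →ₗ[ℝ] (ι → ℂ) := (LinearMap.lsmul ℂ (ι → ℂ) Complex.I).restrictScalars ℝ
  have h1 : f = J ∘ₗ (f ∘ₗ J) := by
    refine LinearMap.ext fun X => ?_
    change f X = Complex.I • f (Complex.I • X)
    rw [hf, smul_neg, ← mul_smul, Complex.I_mul_I, neg_smul, one_smul, neg_neg]
  have h2 : (f ∘ₗ J) ∘ₗ J = -f := by
    refine LinearMap.ext fun X => ?_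
    change f (Complex.I • Complex.I • X) = -f X
    rw [← mul_smul, Complex.I_mul_I, neg_smul, one_smul, map_neg]
  have h3 : LinearMap.trace ℝ _ f = -LinearMap.trace ℝ _ f := by
    conv_lhs => rw [h1, LinearMap.trace_comp_comm', h2, map_neg]
  linarith

/-- The complex rank one map `X ↦ (q · X) V`. -/
def complexRankOne (q V : ι → ℂ) : (ι → ℂ) →ₗ[ℂ] (ι → ℂ) :=
  (dotProductBilin ℂ ℂ q).smulRight V

theorem complexRankOne_apply (q V X : ι → ℂ) : complexRankOne q V X = (q ⬝ᵥ X) • V := rfl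

theorem trace_complexRankOne (q V : ι → ℂ) :
    LinearMap.trace ℂ _ (complexRankOne q V) = q ⬝ᵥ V :=
  LinearMap.trace_smulRight _ _

end ComplexTrace

/-! ### The connection of the conifold and its derivative -/

section Connection

open LinearMap (toContinuousBilinearMap)

variable {n : ℕ}

/-- `1 / |w|²`. -/
def invSq (w : Fin (n + 1) → ℂ) : ℂ := (normSq w : ℂ)⁻¹

theorem invSq_mul {w : Fin (n + 1) → ℂ} (hw : w ≠ 0) : invSq w * (w ⬝ᵥ star w) = 1 := by
  rw [invSq, normSq_eq]
  refine inv_mul_cancel₀ ?_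
  rw [← normSq_eq]
  exact_mod_cast (normSq_pos hw).ne'

theorem conj_invSq (w : Fin (n + 1) → ℂ) : conj (invSq w) = invSq w := by
  rw [invSq, map_inv₀, Complex.conj_ofReal]

theorem hermForm_eq (κ : ℝ) (w a b : Fin (n + 1) → ℂ) :
    hermForm κ w a b = a ⬝ᵥ star b + κ * invSq w * ((a ⬝ᵥ star w) * (w ⬝ᵥ star b)) := by
  rw [hermForm, invSq]
  push_cast
  rfl

/-- The Christoffel symbols of the cone metric on the conifold: those of the Kähler metric on
`ℂ^{n+1}` and the second fundamental form of the conifold. -/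
def conifoldConnection (κ : ℝ) (w : Fin (n + 1) → ℂ) :
    (Fin (n + 1) → ℂ) →L[ℝ] (Fin (n + 1) → ℂ) →L[ℝ] (Fin (n + 1) → ℂ) :=
  toContinuousBilinearMap <| LinearMap.mk₂ ℝ
    (fun X Y => (κ * invSq w) • ((X ⬝ᵥ star w) • Y + (Y ⬝ᵥ star w) • X)
      - (κ * invSq w ^ 2) • (((X ⬝ᵥ star w) * (Y ⬝ᵥ star w)) • w)
      + invSq w • ((X ⬝ᵥ Y) • star w))
    (by intros; ext; simp [add_dotProduct]; ring)
    (by intros; ext; simp; ring)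
    (by intros; ext; simp [dotProduct_add, add_dotProduct]; ring)
    (by intros; ext; simp; ring)

theorem conifoldConnection_apply (κ : ℝ) (w X Y : Fin (n + 1) → ℂ) :
    conifoldConnection κ w X Y = (κ * invSq w) • ((X ⬝ᵥ star w) • Y + (Y ⬝ᵥ star w) • X)
      - (κ * invSq w ^ 2) • (((X ⬝ᵥ star w) * (Y ⬝ᵥ star w)) • w)
      + invSq w • ((X ⬝ᵥ Y) • star w) := rfl

theorem conifoldConnection_symm (κ : ℝ) (w X Y : Fin (n + 1) → ℂ) :
    conifoldConnection κ w X Y = conifoldConnection κ w Y X := by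
  rw [conifoldConnection_apply, conifoldConnection_apply, dotProduct_comm Y X]
  ext; simp; ring

theorem conifoldConnection_mulI (κ : ℝ) (w X Y : Fin (n + 1) → ℂ) :
    conifoldConnection κ w X (Complex.I • Y) = Complex.I • conifoldConnection κ w X Y := by
  rw [conifoldConnection_apply, conifoldConnection_apply]
  ext; simp; ring

theorem contDiffOn_invSq : ContDiffOn ℝ ∞ (invSq (n := n)) {0}ᶜ := by
  have h : ContDiffOn ℝ ∞ (fun w : Fin (n + 1) → ℂ => (((normSq w)⁻¹ : ℝ) : ℂ)) {0}ᶜ :=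
    Complex.ofRealCLM.contDiff.comp_contDiffOn
      (contDiff_normSq.contDiffOn.inv fun w hw => (normSq_pos hw).ne')
  refine h.congr fun w _ => ?_
  rw [invSq, Complex.ofReal_inv]

theorem contDiff_star : ContDiff ℝ ∞ (fun w : Fin (n + 1) → ℂ => star w) :=
  contDiff_pi.2 fun j => Complex.conjCLE.contDiff.comp (contDiff_apply ℝ ℂ j)

theorem contDiff_dotProduct_star (X : Fin (n + 1) → ℂ) :
    ContDiff ℝ ∞ (fun w : Fin (n + 1) → ℂ => X ⬝ᵥ star w) :=
  ContDiff.sum fun j _ => contDiff_const.mul (contDiff_pi.1 contDiff_star j)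

theorem contDiffOn_conifoldConnection (κ : ℝ) :
    ContDiffOn ℝ ∞ (conifoldConnection (n := n) κ) {0}ᶜ := by
  refine contDiffOn_clm_apply.2 fun X => contDiffOn_clm_apply.2 fun Y => ?_
  have h1 := contDiffOn_invSq (n := n)
  have h2 := (contDiff_dotProduct_star X).contDiffOn (s := {0}ᶜ)
  have h3 := (contDiff_dotProduct_star Y).contDiffOn (s := {0}ᶜ)
  have h4 := (contDiff_star (n := n)).contDiffOn (s := {0}ᶜ)
  simp only [conifoldConnection_apply]
  exact (((contDiffOn_const.mul h1).smul ((h2.smul contDiffOn_const).add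
    (h3.smul contDiffOn_const))).sub ((contDiffOn_const.mul (h1.pow 2)).smul
    ((h2.mul h3).smul contDiffOn_id))).add (h1.smul (h4.const_smul (X ⬝ᵥ Y)))

theorem hasDerivAt_invSq {w : Fin (n + 1) → ℂ} (hw : w ≠ 0) (A : Fin (n + 1) → ℂ) :
    HasDerivAt (fun s : ℝ => invSq (w + s • A))
      (-(A ⬝ᵥ star w + w ⬝ᵥ star A) * invSq w ^ 2) 0 := by
  have h := ((hasDerivAt_normSq w A).fun_inv (by simpa using (normSq_pos hw).ne')).ofReal_comp
  have h2 : ((2 * (A ⬝ᵥ star w).re : ℝ) : ℂ) = A ⬝ᵥ star w + w ⬝ᵥ star A := by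
    rw [Matrix.dotProduct_star w A, ← Complex.add_conj]
    rfl
  simp only [Complex.ofReal_inv] at h
  refine h.congr_deriv ?_
  push_cast [← h2]
  simp [invSq, div_eq_mul_inv]

theorem hasDerivAt_dotProduct_star (w A X : Fin (n + 1) → ℂ) :
    HasDerivAt (fun s : ℝ => X ⬝ᵥ star (w + s • A)) (X ⬝ᵥ star A) 0 :=
  hasDerivAt_of_eq_cubic (v₀ := X ⬝ᵥ star w) (v₂ := 0) (v₃ := 0) fun s => by
    simp [dotProduct_add]

theorem hasDerivAt_line (w A : Fin (n + 1) → ℂ) :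
    HasDerivAt (fun s : ℝ => w + s • A) A 0 :=
  hasDerivAt_of_eq_cubic (v₀ := w) (v₂ := 0) (v₃ := 0) fun s => by simp

theorem hasDerivAt_star_line (w A : Fin (n + 1) → ℂ) :
    HasDerivAt (fun s : ℝ => star (w + s • A)) (star A) 0 :=
  hasDerivAt_of_eq_cubic (v₀ := star w) (v₂ := 0) (v₃ := 0) fun s => by simp

/-- The derivative of the Christoffel symbols in the antiholomorphic direction `A`. -/
def dbarConnection (κ : ℝ) (w A X Y : Fin (n + 1) → ℂ) : Fin (n + 1) → ℂ :=
  -(κ * invSq w ^ 2 * (w ⬝ᵥ star A)) • ((X ⬝ᵥ star w) • Y + (Y ⬝ᵥ star w) • X)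
    + (κ * invSq w) • ((X ⬝ᵥ star A) • Y + (Y ⬝ᵥ star A) • X)
    + (2 * κ * invSq w ^ 3 * (w ⬝ᵥ star A)) • (((X ⬝ᵥ star w) * (Y ⬝ᵥ star w)) • w)
    - (κ * invSq w ^ 2) • (((X ⬝ᵥ star A) * (Y ⬝ᵥ star w)
      + (X ⬝ᵥ star w) * (Y ⬝ᵥ star A)) • w)
    - (invSq w ^ 2 * (w ⬝ᵥ star A)) • ((X ⬝ᵥ Y) • star w)
    + invSq w • ((X ⬝ᵥ Y) • star A)

/-- The derivative splits by type: `dbarConnection` is antilinear in A, and the remaining terms,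
through A · w̄ or A itself, are complex linear. -/
theorem fderiv_conifoldConnection (κ : ℝ) {w : Fin (n + 1) → ℂ} (hw : w ≠ 0)
    (A X Y : Fin (n + 1) → ℂ) :
    fderiv ℝ (conifoldConnection κ) w A X Y = dbarConnection κ w A X Y
      - (κ * invSq w ^ 2 * (A ⬝ᵥ star w)) • ((X ⬝ᵥ star w) • Y + (Y ⬝ᵥ star w) • X)
      + (2 * κ * invSq w ^ 3 * (A ⬝ᵥ star w)) • (((X ⬝ᵥ star w) * (Y ⬝ᵥ star w)) • w)
      - (κ * invSq w ^ 2) • (((X ⬝ᵥ star w) * (Y ⬝ᵥ star w)) • A)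
      - (invSq w ^ 2 * (A ⬝ᵥ star w)) • ((X ⬝ᵥ Y) • star w) := by
  have hd : HasFDerivAt (conifoldConnection (n := n) κ) (fderiv ℝ (conifoldConnection κ) w) w :=
    (((contDiffOn_conifoldConnection κ).contDiffAt
      (isOpen_compl_singleton.mem_nhds hw)).differentiableAt (by simp)).hasFDerivAt
  have h1 := (hd.clm_apply (hasFDerivAt_const X w)).clm_apply (hasFDerivAt_const Y w)
  have h2 : fderiv ℝ (conifoldConnection κ) w A X Y
      = fderiv ℝ (fun q => conifoldConnection κ q X Y) w A := by
    rw [h1.fderiv]; simp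
  rw [h2]
  refine fderiv_eq_of_line h1.differentiableAt ?_
  have hτ := hasDerivAt_invSq hw A
  have hX := hasDerivAt_dotProduct_star w A X
  have hY := hasDerivAt_dotProduct_star w A Y
  have h := (((hτ.const_mul (κ : ℂ)).fun_smul ((hX.smul_const Y).fun_add
    (hY.smul_const X))).fun_sub (((hτ.fun_pow 2).const_mul (κ : ℂ)).fun_smul
    ((hX.fun_mul hY).fun_smul (hasDerivAt_line w A)))).fun_add
    (hτ.fun_smul ((hasDerivAt_star_line w A).const_smul (X ⬝ᵥ Y)))
  refine h.congr_deriv ?_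
  ext j
  simp [dbarConnection]
  ring

end Connection

/-! ### Curvature and metric compatibility on the conifold -/

section Conifold

open LinearMap (toContinuousBilinearMap)

variable {n : ℕ}

/-- The complex bilinear form whose null vectors form the conifold, as a real bilinear map. -/
def conifoldForm (n : ℕ) : (Fin (n + 1) → ℂ) →L[ℝ] (Fin (n + 1) → ℂ) →L[ℝ] ℂ :=
  toContinuousBilinearMap <| LinearMap.mk₂ ℝ (fun X Y => X ⬝ᵥ Y)
    (fun _ _ _ => add_dotProduct _ _ _) (fun _ _ _ => smul_dotProduct _ _ _)
    (fun _ _ _ => dotProduct_add _ _ _) (fun _ _ _ => dotProduct_smul _ _ _)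

theorem conifoldForm_apply (X Y : Fin (n + 1) → ℂ) : conifoldForm n X Y = X ⬝ᵥ Y := rfl

/-- The tangent spaces of the conifold. -/
def conifoldTangent (w : Fin (n + 1) → ℂ) : Submodule ℝ (Fin (n + 1) → ℂ) :=
  LinearMap.ker (conifoldForm n w : (Fin (n + 1) → ℂ) →ₗ[ℝ] ℂ)

theorem mem_conifoldTangent {w X : Fin (n + 1) → ℂ} : X ∈ conifoldTangent w ↔ w ⬝ᵥ X = 0 :=
  Iff.rfl

theorem mem_conifold_iff {w : Fin (n + 1) → ℂ} : w ∈ conifold n ↔ w ≠ 0 ∧ w ⬝ᵥ w = 0 := by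
  simp only [conifold, Set.mem_ofPred_eq, dotProduct, sq]

theorem star_dot_star_self {w : Fin (n + 1) → ℂ} (hw : w ⬝ᵥ w = 0) : star w ⬝ᵥ star w = 0 := by
  rw [Matrix.star_dotProduct_star, hw, star_zero]

theorem star_dot_star_tangent {w C : Fin (n + 1) → ℂ} (hC : w ⬝ᵥ C = 0) :
    star w ⬝ᵥ star C = 0 := by
  rw [Matrix.star_dotProduct_star, dotProduct_comm, hC, star_zero]

/-- On the conifold `∂_A Q(B, C) - ∂_B Q(A, C)` cancels the quadratic terms of the curvature, so that
only the antiholomorphic derivatives are left. -/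
theorem curvature_conifoldConnection {κ : ℝ} {w A B C : Fin (n + 1) → ℂ} (hw : w ∈ conifold n)
    (hA : A ∈ conifoldTangent w) (hB : B ∈ conifoldTangent w) :
    curvature (conifoldConnection κ) w B C A
      = dbarConnection κ w A B C - dbarConnection κ w B A C := by
  obtain ⟨h0, hww⟩ := mem_conifold_iff.1 hw
  rw [mem_conifoldTangent] at hA hB
  have h1 := star_dot_star_self hww
  have h2 := invSq_mul h0
  change fderiv ℝ (conifoldConnection κ) w A B C - fderiv ℝ (conifoldConnection κ) w B A C
    + conifoldConnection κ w A (conifoldConnection κ w B C)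
    - conifoldConnection κ w B (conifoldConnection κ w A C) = _
  rw [fderiv_conifoldConnection κ h0, fderiv_conifoldConnection κ h0]
  simp only [conifoldConnection_apply, add_dotProduct, sub_dotProduct, smul_dotProduct,
    dotProduct_add, dotProduct_sub, dotProduct_smul, smul_eq_mul, h1, hA, hB,
    dotProduct_comm A w, dotProduct_comm B w, dotProduct_comm B A]
  generalize w ⬝ᵥ star w = t at *
  generalize A ⬝ᵥ star w = a, B ⬝ᵥ star w = b, C ⬝ᵥ star w = c, A ⬝ᵥ B = ab, A ⬝ᵥ C = ac,
    B ⬝ᵥ C = bc, invSq w = τ at *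
  ext j
  simp only [Pi.add_apply, Pi.sub_apply, Pi.smul_apply, smul_eq_mul, Pi.star_apply]
  -- What survives of the holomorphic derivatives and the quadratic terms is a multiple of τt - 1,
  -- where t = |w|² and τ = 1/t.
  linear_combination (κ ^ 2 * τ ^ 2 * c * (a * B j - b * A j)) * h2

/-- The complex linear map `X ↦ ∂̄_B Q(X, C)`. -/
def dbarLinear (κ : ℝ) (w B C : Fin (n + 1) → ℂ) : (Fin (n + 1) → ℂ) →ₗ[ℂ] (Fin (n + 1) → ℂ) :=
  -(κ * invSq w ^ 2 * (w ⬝ᵥ star B)) • (complexRankOne (star w) C + (C ⬝ᵥ star w) • LinearMap.id)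
    + (κ * invSq w) • (complexRankOne (star B) C + (C ⬝ᵥ star B) • LinearMap.id)
    + (2 * κ * invSq w ^ 3 * (w ⬝ᵥ star B)) • (C ⬝ᵥ star w) • complexRankOne (star w) w
    - (κ * invSq w ^ 2) • ((C ⬝ᵥ star w) • complexRankOne (star B) w
      + (C ⬝ᵥ star B) • complexRankOne (star w) w)
    - (invSq w ^ 2 * (w ⬝ᵥ star B)) • complexRankOne C (star w)
    + invSq w • complexRankOne C (star B)

theorem dbarLinear_apply (κ : ℝ) (w B C X : Fin (n + 1) → ℂ) :
    dbarLinear κ w B C X = dbarConnection κ w B X C := by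
  rw [dbarConnection, dotProduct_comm X C, dotProduct_comm X (star w), dotProduct_comm X (star B)]
  ext j
  simp [dbarLinear, complexRankOne_apply]
  ring

theorem dbarConnection_mulI (κ : ℝ) (w A B C : Fin (n + 1) → ℂ) :
    dbarConnection κ w (Complex.I • A) B C = -(Complex.I • dbarConnection κ w A B C) := by
  ext j
  simp [dbarConnection]
  ring

/-- The trace equals (nκ + 1)(⟨C, B⟩/t - ⟨C, w⟩⟨w, B⟩/t²), that is, nκ + 1 times ∂∂̄ log t. This is
where the exponent (n - 1)/n of the potential is forced. -/
theorem trace_dbarLinear {κ : ℝ} (hκ : κ * n + 1 = 0) {w B C : Fin (n + 1) → ℂ}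
    (hw : w ∈ conifold n) (hC : C ∈ conifoldTangent w) :
    LinearMap.trace ℂ _ (dbarLinear κ w B C ∘ₗ
      (LinearMap.id - invSq w • complexRankOne w (star w))) = 0 := by
  obtain ⟨h0, hww⟩ := mem_conifold_iff.1 hw
  rw [mem_conifoldTangent] at hC
  have h1 := star_dot_star_self hww
  have h2 := invSq_mul h0
  have hκ' : (κ : ℂ) * n + 1 = 0 := by exact_mod_cast hκ
  rw [LinearMap.comp_sub, LinearMap.comp_id, LinearMap.comp_smul, map_sub, map_smul]
  have h3 : ∀ f : (Fin (n + 1) → ℂ) →ₗ[ℂ] (Fin (n + 1) → ℂ),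
      f ∘ₗ complexRankOne w (star w) = complexRankOne w (f (star w)) := fun f =>
    LinearMap.ext fun X => by simp [complexRankOne_apply]
  rw [h3, trace_complexRankOne]
  simp only [dbarLinear, map_add, map_sub, map_smul, trace_complexRankOne, LinearMap.trace_id,
    LinearMap.add_apply, LinearMap.sub_apply, LinearMap.smul_apply, complexRankOne_apply,
    LinearMap.id_apply, dotProduct_add, dotProduct_sub, dotProduct_smul, smul_eq_mul,
    Module.finrank_fintype_fun_eq_card, Fintype.card_fin, hC, hww, h1,
    dotProduct_comm (star w) C, dotProduct_comm (star B), dotProduct_comm (star w) w]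
  push_cast
  generalize w ⬝ᵥ star w = t at *
  generalize w ⬝ᵥ star B = s, C ⬝ᵥ star w = c, C ⬝ᵥ star B = q, invSq w = τ at *
  linear_combination (τ * q - τ ^ 2 * s * c) * hκ'
    + (-2 * κ * τ * q + 3 * κ * τ ^ 2 * s * c + τ ^ 2 * s * c) * h2

/-- The right-hand side is t^{-κ} ∂_A (t^κ H(B, C)), the defining relation of the Christoffel
symbols of the Hermitian metric. The extra term of the connection drops out because w̄ is H-normal
to the conifold. -/
theorem hermForm_conifoldConnection (κ : ℝ) {w A B C : Fin (n + 1) → ℂ} (hw : w ∈ conifold n)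
    (hC : C ∈ conifoldTangent w) :
    hermForm κ w (conifoldConnection κ w A B) C = κ * invSq w * ((A ⬝ᵥ star w) * (B ⬝ᵥ star C)
      + (B ⬝ᵥ star w) * (A ⬝ᵥ star C)
      + (κ - 1) * invSq w * ((A ⬝ᵥ star w) * (B ⬝ᵥ star w) * (w ⬝ᵥ star C))) := by
  obtain ⟨h0, hww⟩ := mem_conifold_iff.1 hw
  have h2 := invSq_mul h0
  rw [hermForm_eq, conifoldConnection_apply]
  simp only [add_dotProduct, sub_dotProduct, smul_dotProduct, smul_eq_mul,
    star_dot_star_self hww, star_dot_star_tangent (mem_conifoldTangent.1 hC)]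
  generalize w ⬝ᵥ star w = t at *
  generalize invSq w = τ at *
  linear_combination (-κ ^ 2 * τ ^ 2 * ((A ⬝ᵥ star w) * (B ⬝ᵥ star w) * (w ⬝ᵥ star C))) * h2

theorem conj_hermForm (κ : ℝ) (w A B : Fin (n + 1) → ℂ) :
    conj (hermForm κ w A B) = hermForm κ w B A := by
  have h : ∀ X Y : Fin (n + 1) → ℂ, conj (X ⬝ᵥ star Y) = Y ⬝ᵥ star X := fun X Y =>
    (Matrix.dotProduct_star Y X).symm
  rw [hermForm_eq, hermForm_eq]
  simp only [map_add, map_mul, h, Complex.conj_ofReal, conj_invSq]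
  ring

theorem re_hermForm_comm (κ : ℝ) (w A B : Fin (n + 1) → ℂ) :
    (hermForm κ w A B).re = (hermForm κ w B A).re := by
  rw [← conj_hermForm, Complex.conj_re]

theorem hasDerivAt_hermForm (κ : ℝ) {w : Fin (n + 1) → ℂ} (hw : w ≠ 0)
    (A B C : Fin (n + 1) → ℂ) :
    HasDerivAt (fun s : ℝ => hermForm κ (w + s • A) B C)
      (κ * invSq w * ((B ⬝ᵥ star A) * (w ⬝ᵥ star C) + (B ⬝ᵥ star w) * (A ⬝ᵥ star C))
        - κ * invSq w ^ 2 * (A ⬝ᵥ star w + w ⬝ᵥ star A) * ((B ⬝ᵥ star w) * (w ⬝ᵥ star C))) 0 := by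
  simp only [hermForm_eq]
  have h1 : HasDerivAt (fun s : ℝ => (w + s • A) ⬝ᵥ star C) (A ⬝ᵥ star C) 0 :=
    hasDerivAt_of_eq_cubic (v₀ := w ⬝ᵥ star C) (v₂ := 0) (v₃ := 0) fun s => by
      simp [add_dotProduct]
  have h := (((hasDerivAt_invSq hw A).const_mul (κ : ℂ)).fun_mul
    ((hasDerivAt_dotProduct_star w A B).fun_mul h1)).const_add (B ⬝ᵥ star C)
  refine h.congr_deriv ?_
  simp
  ring

/-- The left side is the full derivative of t^κ H(B, C) along A, divided by t^κ. Its holomorphic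
half is the first term on the right, and its antiholomorphic half is the conjugate relation with B
and C exchanged. -/
theorem hermForm_compat (κ : ℝ) {w A B C : Fin (n + 1) → ℂ} (hw : w ∈ conifold n)
    (hB : B ∈ conifoldTangent w) (hC : C ∈ conifoldTangent w) :
    κ * invSq w * (A ⬝ᵥ star w + w ⬝ᵥ star A) * hermForm κ w B C
      + (κ * invSq w * ((B ⬝ᵥ star A) * (w ⬝ᵥ star C) + (B ⬝ᵥ star w) * (A ⬝ᵥ star C))
        - κ * invSq w ^ 2 * (A ⬝ᵥ star w + w ⬝ᵥ star A) * ((B ⬝ᵥ star w) * (w ⬝ᵥ star C)))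
      = hermForm κ w (conifoldConnection κ w A B) C
        + hermForm κ w B (conifoldConnection κ w A C) := by
  have h : ∀ X Y : Fin (n + 1) → ℂ, conj (X ⬝ᵥ star Y) = Y ⬝ᵥ star X := fun X Y =>
    (Matrix.dotProduct_star Y X).symm
  rw [← conj_hermForm κ w (conifoldConnection κ w A C) B, hermForm_conifoldConnection κ hw hC,
    hermForm_conifoldConnection κ hw hB, hermForm_eq]
  simp only [map_add, map_sub, map_one, map_mul, h, Complex.conj_ofReal, conj_invSq]
  ring

theorem conifoldMetric_apply {w : Fin (n + 1) → ℂ} (hw : w ≠ 0) (C : ℝ)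
    (A B : Fin (n + 1) → ℂ) :
    conifoldMetric n C w A B = 2 * (C * (((n : ℝ) - 1) / n)
      * normSq w ^ (((n : ℝ) - 1) / n - 1)) * (hermForm (((n : ℝ) - 1) / n - 1) w A B).re :=
  potentialMetric_apply hw C _ A B

theorem contDiffOn_hermForm (κ : ℝ) (A B : Fin (n + 1) → ℂ) :
    ContDiffOn ℝ ∞ (fun w => hermForm κ w A B) {0}ᶜ := by
  simp only [hermForm_eq]
  have h : ContDiff ℝ ∞ fun w : Fin (n + 1) → ℂ => w ⬝ᵥ star B :=
    ContDiff.sum fun j _ => (contDiff_apply ℝ ℂ j).mul contDiff_const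
  exact contDiffOn_const.add ((contDiffOn_const.mul contDiffOn_invSq).mul
    ((contDiff_dotProduct_star A).mul h).contDiffOn)

theorem contDiffOn_conifoldMetric (C : ℝ) (A B : Fin (n + 1) → ℂ) :
    ContDiffOn ℝ ∞ (fun w => conifoldMetric n C w A B) {0}ᶜ := by
  refine ContDiffOn.congr (f := fun w => 2 * (C * (((n : ℝ) - 1) / n)
      * normSq w ^ (((n : ℝ) - 1) / n - 1)) * (hermForm (((n : ℝ) - 1) / n - 1) w A B).re) ?_
    fun w hw => conifoldMetric_apply hw C A B
  exact (contDiffOn_const.mul (contDiffOn_const.mul (contDiffOn_normSq_rpow _))).mul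
    (Complex.reCLM.contDiff.comp_contDiffOn (contDiffOn_hermForm _ A B))

theorem fderiv_conifoldMetric (C : ℝ) {w A X Y : Fin (n + 1) → ℂ} (hw : w ∈ conifold n)
    (hX : X ∈ conifoldTangent w) (hY : Y ∈ conifoldTangent w) :
    fderiv ℝ (fun q => conifoldMetric n C q X Y) w A =
      conifoldMetric n C w (conifoldConnection (((n : ℝ) - 1) / n - 1) w A X) Y
        + conifoldMetric n C w X (conifoldConnection (((n : ℝ) - 1) / n - 1) w A Y) := by
  have h0 := (mem_conifold_iff.1 hw).1
  rw [conifoldMetric_apply h0, conifoldMetric_apply h0, ← mul_add, ← Complex.add_re,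
    ← hermForm_compat _ hw hX hY]
  have heq : (fun q => conifoldMetric n C q X Y) =ᶠ[𝓝 w] fun w => 2 * (C * (((n : ℝ) - 1) / n)
      * normSq w ^ (((n : ℝ) - 1) / n - 1)) * (hermForm (((n : ℝ) - 1) / n - 1) w X Y).re :=
    Filter.eventuallyEq_of_mem (isOpen_compl_singleton.mem_nhds h0) fun w hw =>
      conifoldMetric_apply hw C X Y
  have hd := ((contDiffOn_conifoldMetric C X Y).contDiffAt
    (isOpen_compl_singleton.mem_nhds h0)).differentiableAt (by simp)
  rw [heq.fderiv_eq]
  refine fderiv_eq_of_line (hd.congr_of_eventuallyEq heq.symm) ?_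
  have h1 := ((hasDerivAt_normSq_rpow h0 A (((n : ℝ) - 1) / n - 1)).const_mul
    (C * (((n : ℝ) - 1) / n))).const_mul 2
  have h2 := Complex.reCLM.hasFDerivAt.comp_hasDerivAt 0
    (hasDerivAt_hermForm (((n : ℝ) - 1) / n - 1) h0 A X Y)
  refine (h1.fun_mul h2).congr_deriv ?_
  rw [Real.rpow_sub_one (normSq_pos h0).ne', Complex.add_re, mul_add]
  have h3 : ((2 * (A ⬝ᵥ star w).re : ℝ) : ℂ) = A ⬝ᵥ star w + w ⬝ᵥ star A := by
    rw [Matrix.dotProduct_star w A, ← Complex.add_conj]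
    rfl
  have h4 : invSq w = (((normSq w)⁻¹ : ℝ) : ℂ) := by rw [invSq, Complex.ofReal_inv]
  rw [← h3, h4, ← Complex.ofReal_mul, ← Complex.ofReal_mul, Complex.re_ofReal_mul]
  simp
  ring

theorem isLeviCivita_conifold (n : ℕ) (C : ℝ) :
    IsLeviCivita (conifold n) conifoldTangent {0}ᶜ (conifoldMetric n C)
      (conifoldConnection (((n : ℝ) - 1) / n - 1)) where
  isOpen := isOpen_compl_singleton
  subset _ hw := hw.1
  smooth_metric := contDiffOn_conifoldMetric C
  symm_metric w hw A B := by
    rw [conifoldMetric_apply hw.1, conifoldMetric_apply hw.1, re_hermForm_comm]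
  smooth := contDiffOn_conifoldConnection _
  symm := conifoldConnection_symm _
  compat w hw A _ B hB D hD := fderiv_conifoldMetric C hw hB hD

end Conifold

/-! ### The conifold metric is Kähler and Ricci-flat -/

section Conifold

variable {n : ℕ}

theorem normSq_dotProduct_star_le (X w : Fin (n + 1) → ℂ) :
    Complex.normSq (X ⬝ᵥ star w) ≤ normSq X * normSq w := by
  have h1 : ‖X ⬝ᵥ star w‖ ≤ ∑ j, ‖X j‖ * ‖w j‖ := by
    refine (norm_sum_le _ _).trans_eq (Finset.sum_congr rfl fun j _ => ?_)
    rw [norm_mul, Pi.star_apply, norm_star]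
  have h2 := Finset.sum_mul_sq_le_sq_mul_sq Finset.univ (fun j => ‖X j‖) (fun j => ‖w j‖)
  simp only [Complex.normSq_eq_norm_sq, normSq]
  exact (pow_le_pow_left₀ (norm_nonneg _) h1 2).trans h2

/-- By Cauchy–Schwarz H(X, X) ≥ (1 + κ)|X|². -/
theorem re_hermForm_self_pos {κ : ℝ} (hκ : -1 < κ) (hκ0 : κ ≤ 0) {w X : Fin (n + 1) → ℂ}
    (hw : w ≠ 0) (hX : X ≠ 0) : 0 < (hermForm κ w X X).re := by
  have h1 : hermForm κ w X X
      = ((normSq X + κ * (normSq w)⁻¹ * Complex.normSq (X ⬝ᵥ star w) : ℝ) : ℂ) := by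
    rw [hermForm, Matrix.dotProduct_star w X, RCLike.star_def, Complex.mul_conj, ← normSq_eq]
    push_cast
    rfl
  rw [h1, Complex.ofReal_re]
  have hw' := normSq_pos hw
  have hX' := normSq_pos hX
  have h2 : (normSq w)⁻¹ * Complex.normSq (X ⬝ᵥ star w) ≤ normSq X := by
    rw [inv_mul_le_iff₀ hw', mul_comm]
    exact normSq_dotProduct_star_le X w
  nlinarith [mul_nonneg (neg_nonneg.2 hκ0) (sub_nonneg.2 h2), mul_pos (by linarith : 0 < 1 + κ) hX']

theorem exponent_sub_one {n : ℕ} (hn : 2 ≤ n) : ((n : ℝ) - 1) / n - 1 = -(n : ℝ)⁻¹ := by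
  have : (n : ℝ) ≠ 0 := by positivity
  field_simp
  ring

theorem conifoldMetric_pos (hn : 2 ≤ n) {C : ℝ} (hC : 0 < C) {w X : Fin (n + 1) → ℂ}
    (hw : w ≠ 0) (hX : X ≠ 0) : 0 < conifoldMetric n C w X X := by
  have hn' : (2 : ℝ) ≤ n := by exact_mod_cast hn
  have h1 : (n : ℝ)⁻¹ ≤ 2⁻¹ := inv_anti₀ (by norm_num) hn'
  have h2 : 0 ≤ (n : ℝ)⁻¹ := by positivity
  rw [conifoldMetric_apply hw]
  refine mul_pos (mul_pos two_pos (mul_pos (mul_pos hC (div_pos (by linarith) (by linarith)))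
    (Real.rpow_pos_of_pos (normSq_pos hw) _))) (re_hermForm_self_pos ?_ ?_ hw hX) <;>
  rw [exponent_sub_one hn] <;> linarith

theorem hermForm_mulI (κ : ℝ) (w A B : Fin (n + 1) → ℂ) :
    hermForm κ w (Complex.I • A) (Complex.I • B) = hermForm κ w A B := by
  rw [hermForm_eq, hermForm_eq]
  simp only [star_smul, smul_dotProduct, dotProduct_smul, smul_eq_mul, RCLike.star_def,
    Complex.conj_I]
  linear_combination (-(A ⬝ᵥ star B) - κ * invSq w * ((A ⬝ᵥ star w) * (w ⬝ᵥ star B)))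
    * Complex.I_sq

/-- The complex bilinear form whose null vectors form the conifold. -/
def conifoldFormComplex (n : ℕ) : (Fin (n + 1) → ℂ) →L[ℂ] (Fin (n + 1) → ℂ) →L[ℂ] ℂ :=
  LinearMap.toContinuousBilinearMap (dotProductBilin ℂ ℂ)

theorem conifoldFormComplex_apply (X Y : Fin (n + 1) → ℂ) :
    conifoldFormComplex n X Y = X ⬝ᵥ Y := rfl

theorem conifoldForm_conifoldConnection {κ : ℝ} {w A B : Fin (n + 1) → ℂ} (hw : w ∈ conifold n)
    (hA : A ∈ conifoldTangent w) (hB : B ∈ conifoldTangent w) :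
    conifoldForm n w (conifoldConnection κ w A B) = conifoldForm n A B := by
  obtain ⟨h0, hww⟩ := mem_conifold_iff.1 hw
  rw [conifoldForm_apply, conifoldForm_apply, conifoldConnection_apply]
  simp only [dotProduct_add, dotProduct_sub, dotProduct_smul, mem_conifoldTangent.1 hA,
    mem_conifoldTangent.1 hB, hww, smul_eq_mul]
  linear_combination (A ⬝ᵥ B) * invSq_mul h0

/-- The level set theorem is applied over ℂ, so the chart is holomorphic; restricting scalars yields
the real chart, whose derivative commutes with i. -/
theorem exists_isLinearParam_conifold (κ : ℝ) {p : Fin (n + 1) → ℂ} (hp : p ∈ conifold n) :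
    ∃ (U : Set (Fin n → ℂ)) (φ : (Fin n → ℂ) → Fin (n + 1) → ℂ)
      (L : (Fin (n + 1) → ℂ) →L[ℝ] (Fin n → ℂ)),
      IsLinearParam (conifold n) conifoldTangent U φ L ∧
      Tangential conifoldTangent U φ (conifoldConnection κ) ∧
      (∀ x ∈ U, ∀ a, fderiv ℝ φ x (Complex.I • a) = Complex.I • fderiv ℝ φ x a) ∧
      p ∈ φ '' U := by
  obtain ⟨h0, hpp⟩ := mem_conifold_iff.1 hp
  let β := conifoldFormComplex n
  have hc : ContDiff ℂ ∞ (fun q => β q q) := β.contDiff.clm_apply contDiff_id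
  have hd : ∀ q X, fderiv ℂ (fun q => β q q) q X = (2 : ℂ) • β q X :=
    fderiv_quadratic fun A B => dotProduct_comm A B
  have hsurj : Function.Surjective (fderiv ℂ (fun q => β q q) p) := by
    intro z
    -- p̄ is transverse to the quadric, since p · p̄ = |p|² ≠ 0.
    refine ⟨(z / 2 * invSq p) • star p, ?_⟩
    rw [hd]
    simp only [β, conifoldFormComplex_apply, dotProduct_smul, smul_eq_mul]
    linear_combination z * invSq_mul h0
  obtain ⟨U, φ, L, W, hU, hW, hWO, hpU, hφ, him, hL, hker⟩ :=
    exists_param_levelSet (F := Fin n → ℂ) (fun q => β q q) hc p hsurj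
      (by simp) isOpen_compl_singleton h0
  have hset : {q | β q q = β p p} ∩ W = conifold n ∩ W := by
    ext q
    simp only [Set.mem_inter_iff, Set.mem_ofPred_eq, mem_conifold_iff, β,
      conifoldFormComplex_apply, hpp]
    exact ⟨fun h => ⟨⟨hWO h.2, h.1⟩, h.2⟩, fun h => ⟨h.1.2, h.2⟩⟩
  rw [hset] at him
  have hres : ∀ x ∈ U, fderiv ℝ φ x = (fderiv ℂ φ x).restrictScalars ℝ := fun x hx =>
    ((hφ.contDiffAt (hU.mem_nhds hx)).differentiableAt (by simp)).fderiv_restrictScalars ℝ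
  have hlin : IsLinearParam (conifold n) conifoldTangent U φ (L.restrictScalars ℝ) := by
    refine isLinearParam_of_quadric (β := conifoldForm n) (k := 0) (fun A B => dotProduct_comm A B)
      (fun q hq => (mem_conifold_iff.1 hq).2) (fun _ _ => mem_conifoldTangent) hU
      (hφ.restrict_scalars ℝ) hW him hL fun x hx X hX => ?_
    rw [hres x hx]
    exact hker x hx X (by rw [hd, show β (φ x) X = 0 from hX, smul_zero])
  refine ⟨U, φ, L.restrictScalars ℝ, hlin, tangential_of_quadric (β := conifoldForm n) hlin
    (fun _ _ => mem_conifoldTangent)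
    fun q hq A hA B hB => conifoldForm_conifoldConnection hq hA hB, fun x hx a => ?_, hpU⟩
  rw [hres x hx]
  exact map_smul (fderiv ℂ φ x) Complex.I a

theorem isKahler_conifold (hn : 2 ≤ n) {C : ℝ} (hC : 0 < C) :
    IsKahler n (conifold n) (fun _ => mulI (n + 1)) (conifoldMetric n C) := by
  refine isKahler_of_isLinearParam (J := LinearMap.toContinuousLinearMap (mulI (n + 1)))
    (isLeviCivita_conifold n C) (fun w hw X _ hX => conifoldMetric_pos hn hC hw.1 hX) (fun A => ?_)
    (fun w hw A B => ?_) (fun w A B => conifoldConnection_mulI _ w A B) fun p hp => ?_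
  · change Complex.I • Complex.I • A = -A
    rw [← mul_smul, Complex.I_mul_I, neg_smul, one_smul]
  · change conifoldMetric n C w (Complex.I • A) (Complex.I • B) = _
    rw [conifoldMetric_apply hw.1, conifoldMetric_apply hw.1, hermForm_mulI]
  · exact exists_isLinearParam_conifold _ hp

theorem isEinstein_conifold (hn : 2 ≤ n) (C : ℝ) :
    IsEinstein (Fin n → ℂ) (conifold n) (conifoldMetric n C) 0 := by
  -- Projection onto the tangent space along the normal w̄; its complex linearity is what allows the
  -- trace to be split by type.
  let P : (Fin (n + 1) → ℂ) → (Fin (n + 1) → ℂ) →ₗ[ℂ] (Fin (n + 1) → ℂ) := fun w =>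
    LinearMap.id - invSq w • complexRankOne w (star w)
  have hP : ∀ w X, P w X = X - invSq w • (w ⬝ᵥ X) • star w := fun w X => rfl
  have hPT : ∀ w ∈ conifold n, ∀ X, P w X ∈ conifoldTangent w := by
    intro w hw X
    rw [mem_conifoldTangent, hP, dotProduct_sub, dotProduct_smul, dotProduct_smul, smul_eq_mul,
      smul_eq_mul]
    linear_combination (-(w ⬝ᵥ X)) * invSq_mul (mem_conifold_iff.1 hw).1
  refine isEinstein_of_isLinearParam (isLeviCivita_conifold n C)
    (fun w => (P w).restrictScalars ℝ) hPT (fun w hw X hX => ?_) (fun p hp => ?_)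
    fun w hw B hB D hD => ?_
  · change P w X = X
    rw [hP, mem_conifoldTangent.1 hX, zero_smul, smul_zero, sub_zero]
  · obtain ⟨U, φ, L, h1, h2, -, h3⟩ := exists_isLinearParam_conifold _ hp
    exact ⟨U, φ, L, h1, h2, h3⟩
  · have hκ : (((n : ℝ) - 1) / n - 1) * n + 1 = 0 := by
      have : (n : ℝ) ≠ 0 := by positivity
      field_simp
      ring
    rw [zero_mul]
    have ht := trace_dbarLinear hκ (B := B) hw hD
    generalize (((n : ℝ) - 1) / n - 1) = κ at *
    have hlin := trace_restrictScalars (dbarLinear κ w B D ∘ₗ P w)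
    rw [ht, Complex.zero_re, mul_zero] at hlin
    -- Adding back the complex linear part ∂̄_B Q(·, D), which is traceless on the tangent space,
    -- leaves the antilinear map X ↦ ∂̄_{PX} Q(B, D).
    have hanti := trace_eq_zero_of_antilinear (curvature (conifoldConnection κ) w B D ∘ₗ
      (P w).restrictScalars ℝ + (dbarLinear κ w B D ∘ₗ P w).restrictScalars ℝ) fun X => by
        have h : ∀ X, (curvature (conifoldConnection κ) w B D ∘ₗ (P w).restrictScalars ℝ
            + (dbarLinear κ w B D ∘ₗ P w).restrictScalars ℝ) X
            = dbarConnection κ w (P w X) B D := by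
          intro X
          change curvature (conifoldConnection κ) w B D (P w X) + dbarLinear κ w B D (P w X) = _
          rw [curvature_conifoldConnection hw (hPT w hw X) hB, dbarLinear_apply, sub_add_cancel]
        rw [h, h, map_smul, dbarConnection_mulI]
    rwa [map_add, hlin, add_zero] at hanti

end Conifold

/-! ### Polar coordinates and the isometry with the cone -/

section Polar

variable {n : ℕ}

/-- The real part of a complex vector. -/
def reVec {m : ℕ} (w : Fin m → ℂ) : Fin m → ℝ := fun j => (w j).re

/-- The imaginary part of a complex vector. -/
def imVec {m : ℕ} (w : Fin m → ℂ) : Fin m → ℝ := fun j => (w j).im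

theorem re_dotProduct {m : ℕ} (w a : Fin m → ℂ) :
    (w ⬝ᵥ a).re = reVec w ⬝ᵥ reVec a - imVec w ⬝ᵥ imVec a := by
  simp [dotProduct, reVec, imVec]

theorem im_dotProduct {m : ℕ} (w a : Fin m → ℂ) :
    (w ⬝ᵥ a).im = reVec w ⬝ᵥ imVec a + imVec w ⬝ᵥ reVec a := by
  simp [dotProduct, reVec, imVec, Finset.sum_add_distrib]

theorem reVec_star {m : ℕ} (w : Fin m → ℂ) : reVec (star w) = reVec w := by
  ext; simp [reVec]

theorem imVec_star {m : ℕ} (w : Fin m → ℂ) : imVec (star w) = -imVec w := by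
  ext; simp [imVec]

theorem normSq_eq_add (w : Fin (n + 1) → ℂ) :
    normSq w = reVec w ⬝ᵥ reVec w + imVec w ⬝ᵥ imVec w := by
  simp [normSq, dotProduct, reVec, imVec, Complex.normSq_apply, Finset.sum_add_distrib]

theorem mem_conifold_iff_real {w : Fin (n + 1) → ℂ} :
    w ∈ conifold n ↔ 0 < reVec w ⬝ᵥ reVec w ∧ imVec w ⬝ᵥ imVec w = reVec w ⬝ᵥ reVec w ∧
      reVec w ⬝ᵥ imVec w = 0 := by
  rw [mem_conifold_iff, Complex.ext_iff, re_dotProduct, im_dotProduct, Complex.zero_re,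
    Complex.zero_im, dotProduct_comm (imVec w) (reVec w)]
  have h := normSq_eq_add w
  constructor
  · rintro ⟨h1, h2, h3⟩
    have := normSq_pos h1
    exact ⟨by linarith, by linarith, by linarith⟩
  · rintro ⟨h1, h2, h3⟩
    refine ⟨?_, by linarith, by linarith⟩
    rintro rfl
    simp [reVec, dotProduct] at h1

theorem polar_eq (C : ℝ) (w : Fin (n + 1) → ℂ) :
    polar n C w = (√(2 * C) * normSq w ^ (((n : ℝ) - 1) / (2 * n)),
      ((√(reVec w ⬝ᵥ reVec w))⁻¹ • reVec w, (√(reVec w ⬝ᵥ reVec w))⁻¹ • imVec w)) := by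
  simp only [polar, dotProduct, reVec, ← sq, Prod.mk.injEq, true_and]
  constructor <;> ext j <;> simp [div_eq_inv_mul, reVec, imVec]

theorem contDiff_reVec {m : ℕ} : ContDiff ℝ ∞ (reVec (m := m)) :=
  contDiff_pi.2 fun j => Complex.reCLM.contDiff.comp (contDiff_apply ℝ ℂ j)

theorem contDiff_imVec {m : ℕ} : ContDiff ℝ ∞ (imVec (m := m)) :=
  contDiff_pi.2 fun j => Complex.imCLM.contDiff.comp (contDiff_apply ℝ ℂ j)

theorem contDiff_dotProduct_self {m : ℕ} : ContDiff ℝ ∞ fun u : Fin m → ℝ => u ⬝ᵥ u :=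
  ContDiff.sum fun j _ => (contDiff_apply ℝ ℝ j).mul (contDiff_apply ℝ ℝ j)

theorem contDiffOn_polar (C : ℝ) :
    ContDiffOn ℝ ∞ (polar n C) {w | reVec w ⬝ᵥ reVec w ≠ 0} := by
  have h0 : ContDiffOn ℝ ∞ (fun w : Fin (n + 1) → ℂ => (√(reVec w ⬝ᵥ reVec w))⁻¹)
      {w | reVec w ⬝ᵥ reVec w ≠ 0} := by
    refine ContDiffOn.inv (ContDiffOn.sqrt
      (contDiff_dotProduct_self.comp contDiff_reVec).contDiffOn fun w hw => hw) fun w hw => ?_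
    refine (Real.sqrt_pos.2 (lt_of_le_of_ne ?_ (Ne.symm hw))).ne'
    exact Finset.sum_nonneg fun j _ => mul_self_nonneg _
  rw [funext fun w => polar_eq C w]
  refine ContDiffOn.prodMk (contDiffOn_const.mul ((contDiffOn_normSq_rpow _).mono ?_))
    (ContDiffOn.prodMk (h0.smul contDiff_reVec.contDiffOn) (h0.smul contDiff_imVec.contDiffOn))
  rintro w hw rfl
  simp [reVec, dotProduct] at hw

/-- The inverse `(r, (û, v̂)) ↦ |u| (û + i v̂)` of the polar coordinates. -/
def polarInv (n : ℕ) (C : ℝ) (q : ℝ × ((Fin (n + 1) → ℝ) × (Fin (n + 1) → ℝ))) :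
    Fin (n + 1) → ℂ :=
  -- Solving r = √(2C) t^{(n-1)/(2n)} gives t, and |u| = √(t/2) because |u| = |v| on the conifold.
  fun j => (√((q.1 / √(2 * C)) ^ (2 * (n : ℝ) / (n - 1)) / 2) : ℂ) * (q.2.1 j + q.2.2 j * Complex.I)

theorem reVec_polarInv (C : ℝ) (q : ℝ × ((Fin (n + 1) → ℝ) × (Fin (n + 1) → ℝ))) :
    reVec (polarInv n C q) = √((q.1 / √(2 * C)) ^ (2 * (n : ℝ) / (n - 1)) / 2) • q.2.1 := by
  ext j
  simp only [reVec, polarInv, Complex.re_ofReal_mul]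
  simp

theorem imVec_polarInv (C : ℝ) (q : ℝ × ((Fin (n + 1) → ℝ) × (Fin (n + 1) → ℝ))) :
    imVec (polarInv n C q) = √((q.1 / √(2 * C)) ^ (2 * (n : ℝ) / (n - 1)) / 2) • q.2.2 := by
  ext j
  simp only [imVec, polarInv, Complex.im_ofReal_mul]
  simp

theorem contDiffOn_polarInv {C : ℝ} (hC : 0 < C) :
    ContDiffOn ℝ ∞ (polarInv n C) {q | 0 < q.1} := by
  have hpos : ∀ q ∈ {q : ℝ × ((Fin (n + 1) → ℝ) × (Fin (n + 1) → ℝ)) | 0 < q.1},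
      0 < q.1 / √(2 * C) := fun q hq => div_pos hq (Real.sqrt_pos.2 (by positivity))
  have h1 : ContDiffOn ℝ ∞ (fun q : ℝ × ((Fin (n + 1) → ℝ) × (Fin (n + 1) → ℝ)) =>
      √((q.1 / √(2 * C)) ^ (2 * (n : ℝ) / (n - 1)) / 2)) {q | 0 < q.1} :=
    (((contDiff_fst.div_const _).contDiffOn.rpow_const_of_ne fun q hq => (hpos q hq).ne').div_const
      2).sqrt fun q hq => (div_pos (Real.rpow_pos_of_pos (hpos q hq) _) two_pos).ne'
  refine contDiffOn_pi.2 fun j => (Complex.ofRealCLM.contDiff.comp_contDiffOn h1).mul ?_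
  have h2 : ContDiff ℝ ∞ fun q : ℝ × ((Fin (n + 1) → ℝ) × (Fin (n + 1) → ℝ)) => (q.2.1 j : ℂ) :=
    Complex.ofRealCLM.contDiff.comp ((contDiff_apply ℝ ℝ j).comp (contDiff_fst.comp contDiff_snd))
  have h3 : ContDiff ℝ ∞ fun q : ℝ × ((Fin (n + 1) → ℝ) × (Fin (n + 1) → ℝ)) => (q.2.2 j : ℂ) :=
    Complex.ofRealCLM.contDiff.comp ((contDiff_apply ℝ ℝ j).comp (contDiff_snd.comp contDiff_snd))
  exact (h2.add (h3.mul contDiff_const)).contDiffOn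

theorem mem_unitConormal_iff_dotProduct {p : (Fin (n + 1) → ℝ) × (Fin (n + 1) → ℝ)} :
    p ∈ unitConormal n ↔ p.1 ⬝ᵥ p.1 = 1 ∧ p.2 ⬝ᵥ p.2 = 1 ∧ p.1 ⬝ᵥ p.2 = 0 := by
  simp [unitConormal, dotProduct, sq]

theorem mapsTo_polar {C : ℝ} (hC : 0 < C) :
    Set.MapsTo (polar n C) (conifold n) (cone (unitConormal n)) := by
  intro w hw
  have hw0 := (mem_conifold_iff.1 hw).1
  obtain ⟨h1, h2, h3⟩ := mem_conifold_iff_real.1 hw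
  rw [polar_eq]
  refine ⟨mul_pos (Real.sqrt_pos.2 (by positivity)) (Real.rpow_pos_of_pos (normSq_pos hw0) _), ?_⟩
  rw [mem_unitConormal_iff_dotProduct]
  simp only [smul_dotProduct, dotProduct_smul, smul_eq_mul, h2, h3, mul_zero, and_true, and_self]
  rw [← mul_assoc, ← mul_inv, Real.mul_self_sqrt h1.le, inv_mul_cancel₀ h1.ne']

theorem leftInvOn_polarInv (hn : 2 ≤ n) {C : ℝ} (hC : 0 < C) :
    Set.LeftInvOn (polarInv n C) (polar n C) (conifold n) := by
  intro w hw
  have hw0 := (mem_conifold_iff.1 hw).1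
  obtain ⟨h1, h2, h3⟩ := mem_conifold_iff_real.1 hw
  have hn' : (2 : ℝ) ≤ n := by exact_mod_cast hn
  have hC' : √(2 * C) ≠ 0 := (Real.sqrt_pos.2 (by positivity)).ne'
  have he : ((n : ℝ) - 1) / (2 * n) * (2 * n / (n - 1)) = 1 := by
    have : (n : ℝ) - 1 ≠ 0 := by linarith
    field_simp
  have hρ : ((polar n C w).1 / √(2 * C)) ^ (2 * (n : ℝ) / (n - 1)) / 2 = reVec w ⬝ᵥ reVec w := by
    rw [polar_eq, mul_div_cancel_left₀ _ hC', ← Real.rpow_mul (normSq_nonneg w), he, Real.rpow_one,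
      normSq_eq_add, h2]
    ring
  have hs : √(reVec w ⬝ᵥ reVec w) ≠ 0 := (Real.sqrt_pos.2 h1).ne'
  ext j
  apply Complex.ext
  · have := congrFun (reVec_polarInv C (polar n C w)) j
    rw [hρ, polar_eq, smul_smul, mul_inv_cancel₀ hs, one_smul] at this
    rwa [polar_eq]
  · have := congrFun (imVec_polarInv C (polar n C w)) j
    rw [hρ, polar_eq, smul_smul, mul_inv_cancel₀ hs, one_smul] at this
    rwa [polar_eq]

theorem polarInv_mem_and_polar {C : ℝ} (hn : 2 ≤ n) (hC : 0 < C)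
    {q : ℝ × ((Fin (n + 1) → ℝ) × (Fin (n + 1) → ℝ))} (hq : q ∈ cone (unitConormal n)) :
    polarInv n C q ∈ conifold n ∧ polar n C (polarInv n C q) = q := by
  obtain ⟨r, u, v⟩ := q
  obtain ⟨hr, hp⟩ := hq
  replace hr : 0 < r := hr
  obtain ⟨h1, h2, h3⟩ := mem_unitConormal_iff_dotProduct.1 hp
  simp only at h1 h2 h3
  have hn' : (2 : ℝ) ≤ n := by exact_mod_cast hn
  have hC' : 0 < √(2 * C) := Real.sqrt_pos.2 (by positivity)
  have ht := Real.rpow_pos_of_pos (div_pos hr hC') (2 * (n : ℝ) / (n - 1))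
  have he : 2 * (n : ℝ) / (n - 1) * (((n : ℝ) - 1) / (2 * n)) = 1 := by
    have : (n : ℝ) - 1 ≠ 0 := by linarith
    field_simp
  have hre := reVec_polarInv C (r, (u, v))
  have him := imVec_polarInv C (r, (u, v))
  set t := (r / √(2 * C)) ^ (2 * (n : ℝ) / (n - 1)) with htdef
  simp only at hre him
  have hρ : 0 < √(t / 2) := Real.sqrt_pos.2 (by positivity)
  have hρ2 : √(t / 2) * √(t / 2) = t / 2 := Real.mul_self_sqrt (by positivity)
  have huu : reVec (polarInv n C (r, (u, v))) ⬝ᵥ reVec (polarInv n C (r, (u, v))) = t / 2 := by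
    simp only [hre, smul_dotProduct, dotProduct_smul, smul_eq_mul, h1, mul_one, hρ2]
  have hvv : imVec (polarInv n C (r, (u, v))) ⬝ᵥ imVec (polarInv n C (r, (u, v))) = t / 2 := by
    simp only [him, smul_dotProduct, dotProduct_smul, smul_eq_mul, h2, mul_one, hρ2]
  constructor
  · rw [mem_conifold_iff_real, huu, hvv]
    refine ⟨by positivity, rfl, ?_⟩
    simp only [hre, him, smul_dotProduct, dotProduct_smul, smul_eq_mul, h3, mul_zero]
  · rw [polar_eq, normSq_eq_add, huu, hvv, hre, him, add_halves, htdef,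
      ← Real.rpow_mul (div_pos hr hC').le, he, Real.rpow_one, mul_div_cancel₀ _ hC'.ne', ← htdef,
      smul_smul, smul_smul, inv_mul_cancel₀ hρ.ne', one_smul, one_smul]

theorem isDiffeoWith_polar (hn : 2 ≤ n) {C : ℝ} (hC : 0 < C) :
    IsDiffeoWith (conifold n) (cone (unitConormal n)) (polar n C) (polarInv n C) where
  bijOn := ⟨mapsTo_polar hC, (leftInvOn_polarInv hn hC).injOn, fun _ hq =>
    ⟨_, (polarInv_mem_and_polar hn hC hq).1, (polarInv_mem_and_polar hn hC hq).2⟩⟩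
  leftInvOn := leftInvOn_polarInv hn hC
  smooth := ⟨_, isOpen_ne_fun (contDiff_dotProduct_self.comp contDiff_reVec).continuous
    continuous_const, fun _ hw => (mem_conifold_iff_real.1 hw).1.ne', contDiffOn_polar C⟩
  smooth_inv := ⟨_, isOpen_lt continuous_const continuous_fst, fun _ hq => hq.1,
    contDiffOn_polarInv hC⟩

theorem dotProduct_eq_zero_of_mem_tangentVectors {w a : Fin (n + 1) → ℂ}
    (ha : a ∈ tangentVectors (conifold n) w) : w ⬝ᵥ a = 0 := by
  obtain ⟨γ, rfl, hM, hγ⟩ := ha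
  have h1 : HasDerivAt (fun s => ∑ j, γ s j * γ s j) (∑ j, (a j * γ 0 j + γ 0 j * a j)) 0 :=
    HasDerivAt.fun_sum fun j _ => ((hasDerivAt_pi.1 hγ) j).mul ((hasDerivAt_pi.1 hγ) j)
  have h2 : (fun s => ∑ j, γ s j * γ s j) =ᶠ[𝓝 0] fun _ => (0 : ℂ) :=
    hM.mono fun s hs => (mem_conifold_iff.1 hs).2
  have h3 := h1.unique ((hasDerivAt_const (0 : ℝ) (0 : ℂ)).congr_of_eventuallyEq h2)
  have h4 : ∑ j, (a j * γ 0 j + γ 0 j * a j) = 2 * (γ 0 ⬝ᵥ a) := by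
    rw [dotProduct, Finset.mul_sum]
    exact Finset.sum_congr rfl fun j _ => by ring
  rw [h4] at h3
  simpa using h3

theorem fderiv_polar (C : ℝ) {w a : Fin (n + 1) → ℂ} (hw : w ∈ conifold n) (ha : w ⬝ᵥ a = 0)
    {ρ : ℝ} (hρ : √(reVec w ⬝ᵥ reVec w) = ρ) :
    fderiv ℝ (polar n C) w a =
      (√(2 * C) * (4 * (reVec w ⬝ᵥ reVec a) * (((n : ℝ) - 1) / (2 * n))
          * normSq w ^ (((n : ℝ) - 1) / (2 * n) - 1)),
        (ρ⁻¹ • reVec a - ((reVec w ⬝ᵥ reVec a) / ρ ^ 3) • reVec w,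
          ρ⁻¹ • imVec a - ((reVec w ⬝ᵥ reVec a) / ρ ^ 3) • imVec w)) := by
  obtain ⟨h1, h2, h3⟩ := mem_conifold_iff_real.1 hw
  have hρ0 : 0 < ρ := hρ ▸ Real.sqrt_pos.2 h1
  have hat := (isOpen_ne_fun (contDiff_dotProduct_self.comp
    (contDiff_reVec (m := n + 1))).continuous continuous_const).mem_nhds h1.ne'
  refine fderiv_eq_of_line (((contDiffOn_polar C).contDiffAt hat).differentiableAt (by simp)) ?_
  have hre : ∀ s : ℝ, reVec (w + s • a) = reVec w + s • reVec a := fun s => by ext; simp [reVec]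
  have him : ∀ s : ℝ, imVec (w + s • a) = imVec w + s • imVec a := fun s => by ext; simp [imVec]
  have hl : ∀ X Y : Fin (n + 1) → ℝ, HasDerivAt (fun s : ℝ => X + s • Y) Y 0 := fun X Y =>
    hasDerivAt_of_eq_cubic (v₀ := X) (v₂ := 0) (v₃ := 0) fun s => by simp
  have hq : HasDerivAt (fun s : ℝ => (reVec w + s • reVec a) ⬝ᵥ (reVec w + s • reVec a))
      (2 * (reVec w ⬝ᵥ reVec a)) 0 :=
    hasDerivAt_of_eq_cubic (v₀ := reVec w ⬝ᵥ reVec w) (v₂ := reVec a ⬝ᵥ reVec a) (v₃ := 0)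
      fun s => by
        simp only [add_dotProduct, dotProduct_add, smul_dotProduct, dotProduct_smul, smul_eq_mul,
          dotProduct_comm (reVec a) (reVec w)]
        ring
  have hinv : HasDerivAt
      (fun s : ℝ => (√((reVec w + s • reVec a) ⬝ᵥ (reVec w + s • reVec a)))⁻¹)
      (-((reVec w ⬝ᵥ reVec a) / ρ ^ 3)) 0 := by
    have := (hq.sqrt (by simpa using h1.ne')).inv (by simpa [hρ] using hρ0.ne')
    refine this.congr_deriv ?_
    simp only [zero_smul, add_zero, hρ]
    field_simp
  have hr := (hasDerivAt_normSq_rpow (mem_conifold_iff.1 hw).1 a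
    (((n : ℝ) - 1) / (2 * n))).const_mul √(2 * C)
  -- The real part of w · a = 0 says u · Re a = v · Im a, so both halves of the derivative of t
  -- agree.
  have hx : (a ⬝ᵥ star w).re = 2 * (reVec w ⬝ᵥ reVec a) := by
    have := congrArg Complex.re ha
    rw [re_dotProduct, Complex.zero_re] at this
    rw [re_dotProduct, reVec_star, imVec_star, dotProduct_neg, dotProduct_comm (reVec a),
      dotProduct_comm (imVec a)]
    linarith
  rw [funext fun s : ℝ => polar_eq C (w + s • a)]
  simp only [hre, him]
  refine HasDerivAt.prodMk (hr.congr_deriv ?_) (HasDerivAt.prodMk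
    ((hinv.smul (hl _ _)).congr_deriv ?_) ((hinv.smul (hl _ _)).congr_deriv ?_))
  · rw [hx]; ring
  · simp [hρ, sub_eq_add_neg]
  · simp [hρ, sub_eq_add_neg]

/-- Tangency expresses the products of v with Re a, Im a through those of u, and likewise for b.
Both metrics then depend on the same few scalar products and can be compared term by term. -/
theorem pullsBackTo_polar (hn : 2 ≤ n) {C : ℝ} (hC : 0 < C) :
    PullsBackTo (conifold n) (conifoldMetric n C) (coneMetric (linkMetric n)) (polar n C) := by
  intro w hw a ha b hb
  have hw0 := (mem_conifold_iff.1 hw).1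
  replace ha := dotProduct_eq_zero_of_mem_tangentVectors ha
  replace hb := dotProduct_eq_zero_of_mem_tangentVectors hb
  obtain ⟨h1, h2, h3⟩ := mem_conifold_iff_real.1 hw
  obtain ⟨ρ, hρ⟩ : ∃ ρ, √(reVec w ⬝ᵥ reVec w) = ρ := ⟨_, rfl⟩
  have hρ0 : 0 < ρ := hρ ▸ Real.sqrt_pos.2 h1
  have huu : reVec w ⬝ᵥ reVec w = ρ ^ 2 := by rw [← hρ, Real.sq_sqrt h1.le]
  have hn0 : (n : ℝ) ≠ 0 := by positivity
  have ht : normSq w = 2 * ρ ^ 2 := by rw [normSq_eq_add, h2, huu]; ring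
  have ht0 := normSq_pos hw0
  rw [coneMetric, LinearMap.mk₂_apply, fderiv_polar C hw ha hρ, fderiv_polar C hw hb hρ,
    linkMetric_apply, conifoldMetric_apply hw0, polar_eq, hρ]
  -- All powers of t are expressed through T = t^{(n-1)/(2n)} and t itself, and C through c = √(2C),
  -- so that the identity becomes rational.
  have hα : normSq w ^ (((n : ℝ) - 1) / n - 1)
      = (normSq w ^ (((n : ℝ) - 1) / (2 * n))) ^ 2 / normSq w := by
    rw [Real.rpow_sub_one ht0.ne', ← Real.rpow_mul_natCast ht0.le]
    congr 2
    push_cast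
    field_simp
  rw [hα, Real.rpow_sub_one ht0.ne', exponent_sub_one hn]
  generalize normSq w ^ (((n : ℝ) - 1) / (2 * n)) = T
  have hC2 : √(2 * C) ^ 2 = 2 * C := Real.sq_sqrt (by positivity)
  generalize √(2 * C) = c at hC2
  obtain rfl : C = c ^ 2 / 2 := by linarith
  have hv1 := congrArg Complex.re ha
  have hv2 := congrArg Complex.im ha
  have hv3 := congrArg Complex.re hb
  have hv4 := congrArg Complex.im hb
  simp only [re_dotProduct, im_dotProduct, Complex.zero_re, Complex.zero_im] at hv1 hv2 hv3 hv4
  have e1 : imVec w ⬝ᵥ imVec a = reVec w ⬝ᵥ reVec a := by linarith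
  have e2 : imVec w ⬝ᵥ reVec a = -(reVec w ⬝ᵥ imVec a) := by linarith
  have e3 : imVec w ⬝ᵥ imVec b = reVec w ⬝ᵥ reVec b := by linarith
  have e4 : imVec w ⬝ᵥ reVec b = -(reVec w ⬝ᵥ imVec b) := by linarith
  simp only [hermForm, Complex.add_re, Complex.mul_re, Complex.ofReal_re, Complex.ofReal_im,
    zero_mul, sub_zero, re_dotProduct,
    im_dotProduct, reVec_star, imVec_star, dotProduct_neg, sub_neg_eq_add, sub_dotProduct,
    dotProduct_sub, smul_dotProduct, dotProduct_smul, smul_eq_mul,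
    dotProduct_comm (reVec a) (reVec w), dotProduct_comm (reVec a) (imVec w),
    dotProduct_comm (imVec a) (reVec w), dotProduct_comm (imVec a) (imVec w),
    e1, e2, e3, e4, h2, h3, huu, ht]
  field_simp
  ring

end Polar

end ConifoldCone

end

theorem mainTheorem2 (n : ℕ) (hn : 2 ≤ n) (C : ℝ) (hC : 0 < C) :
    (ConifoldCone.IsKahler n (ConifoldCone.conifold n)
        (fun _ => ConifoldCone.mulI (n + 1)) (ConifoldCone.conifoldMetric n C) ∧
      ConifoldCone.IsEinstein (Fin n → ℂ) (ConifoldCone.conifold n)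
        (ConifoldCone.conifoldMetric n C) 0) ∧
    (ConifoldCone.IsDiffeo (ConifoldCone.conifold n)
        (ConifoldCone.cone (ConifoldCone.unitConormal n)) (ConifoldCone.polar n C) ∧
      ConifoldCone.PullsBackTo (ConifoldCone.conifold n) (ConifoldCone.conifoldMetric n C)
        (ConifoldCone.coneMetric (ConifoldCone.linkMetric n)) (ConifoldCone.polar n C)) ∧
    ConifoldCone.IsSasakiEinstein n (ConifoldCone.unitConormal n) (ConifoldCone.linkMetric n) := by
  have hK := ConifoldCone.isKahler_conifold hn hC
  have hD := ConifoldCone.isDiffeoWith_polar hn hC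
  have hP := ConifoldCone.pullsBackTo_polar hn hC
  exact ⟨⟨hK, ConifoldCone.isEinstein_conifold hn C⟩,
    ⟨⟨hD.bijOn, hD.smooth, _, hD.leftInvOn, hD.smooth_inv⟩, hP⟩,
    ⟨ConifoldCone.isRiemannianMetric_link hn, _, hK.of_diffeo hD hP⟩,
    _, ConifoldCone.isEinstein_link hn⟩
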